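/- For a prime power $q$ let $\mathbb{F}_q$ be the field with $q$ elements, and equip $\mathbb{F}_q^n$ with the standard inner product $v\cdot w=\sum_i v_iw_i$. An $[n,k]_q$ code is a $k$-dimensional subspace $C\le\mathbb{F}_q^n$; it is self-orthogonal if $v\cdot w=0$ for all $v,w\in C$. For $C\neq\{0\}$ let $d(C)$ be the minimum number of nonzero coordinates of a nonzero vector of $C$. Let $\Sigma_q(n,k)$ be the set of self-orthogonal $[n,k]_q$ codes, let $\sigma_q(n,k)=|\Sigma_q(n,k)|$, and let $w(\mathbb{F}_q^n)$ (the Witt index) be the largest dimension of a self-orthogonal subspace of $\mathbb{F}_q^n$. Let $n,d,k$ be fixed integers with $4\le d<n$ and $1\le k\le n-d$. Then \[ \frac{|\{C\in\Sigma_q(n,k)\mid d(C)\le d-1\}|}{\sigma_q(n,k)}\;\sim\;\binom{n}{d-1}\,q^{\,d+k-n-2} \] as $q\to\infty$ through the prime powers $q$ with $k\le w(\mathbb{F}_q^n)$; that is, the quotient of the two sides tends to $1$. -/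

import Mathlib

open Filter Asymptotics
open scoped Asymptotics Filter

/-- The orthogonal `C^⊥ = {v | v ⬝ w = 0 for all w ∈ C}` of a code `C ≤ F^n` with respect to the
standard inner product. -/
def dualCode {F : Type*} [Field F] {n : ℕ} (C : Submodule F (Fin n → F)) :
    Submodule F (Fin n → F) where
  carrier := {v | ∀ w ∈ C, v ⬝ᵥ w = 0}
  add_mem' := by
    intro a b ha hb w hw
    rw [add_dotProduct, ha w hw, hb w hw, add_zero]
  zero_mem' := by
    intro w _
    exact zero_dotProduct w
  smul_mem' := by
    intro c v hv w hw
    rw [smul_dotProduct, hv w hw, smul_zero]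

/-- A code is self-orthogonal if it is contained in its orthogonal. -/
def IsSelfOrthogonal {F : Type*} [Field F] {n : ℕ} (C : Submodule F (Fin n → F)) : Prop :=
  C ≤ dualCode C

/-- The Witt index of `F^n` with the standard inner product: the largest dimension of a
self-orthogonal code (the set is non-empty, and bounded by `n`). -/
noncomputable def wittIndex (F : Type*) [Field F] (n : ℕ) : ℕ :=
  sSup {m : ℕ | ∃ C : Submodule F (Fin n → F), IsSelfOrthogonal C ∧ Module.finrank F C = m}

/-- The set of all `k`-dimensional self-orthogonal codes in `F^n`. -/
def selfOrthogonalCodes (F : Type*) [Field F] (n k : ℕ) : Set (Submodule F (Fin n → F)) :=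
  {C | Module.finrank F C = k ∧ IsSelfOrthogonal C}

open Classical in
/-- The minimum Hamming distance of a (nonzero) code, `min {wt v | v ∈ C, v ≠ 0}`, where
`wt v = hammingNorm v` is the number of nonzero coordinates. -/
noncomputable def minDistance {F : Type*} [Field F] {n : ℕ}
    (C : Submodule F (Fin n → F)) : ℕ :=
  sInf {m : ℕ | ∃ v ∈ C, v ≠ 0 ∧ hammingNorm v = m}

/-- The proportion, among the `k`-dimensional self-orthogonal codes in `F^n`, of those whose
minimum distance is at most `d - 1`. -/
noncomputable def smallDistanceProportion (F : Type*) [Field F] (n k d : ℕ) : ℝ :=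
  ((selfOrthogonalCodes F n k ∩ {C | minDistance C ≤ d - 1}).ncard : ℝ) /
    ((selfOrthogonalCodes F n k).ncard : ℝ)

/-!
The proof compares first and second moments of the number of vectors of small weight in a random
self-orthogonal code; `q` is the order of the field, which is allowed to be even or odd,
`m = d - 1`, and `1` is the all-ones vector.

The key point is that every isotropic vector outside the span of `1` lies in the same number `N` of
self-orthogonal codes of dimension `k`, and that the same holds relative to a subspace `Z`: every
isotropic `w` orthogonal to `Z` and outside `Z + ⟨1⟩` lies in the same number of codes containing
`Z` (`numThrough_eq_of_generic`). No form of Witt's theorem is needed. Two isotropic vectors that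
are not orthogonal are exchanged by the isometry `x ↦ x + ((x · u) / (w · w')) u`, `u = w - w'`,
which is a reflection in odd and a transvection in even characteristic, and any two such vectors
are connected by a chain of isotropic vectors with nonzero consecutive products. Double
counting then shows that `N` is asymptotically `q^(k-n+1)` times the number of codes
(`numThrough_mul_card_generic_le`, `pow_mul_card_codes_le`), because `F^n` has
`q^(n-1) + O(q^(n-2))` isotropic vectors.

The latter estimate (`isoCount_coordSubspace_bounds`) holds in every dimension `m ≥ 3`. In
characteristic two the isotropic vectors form a hyperplane. In odd characteristic, take an isotropic
`v ≠ 0`; every line in direction `v` outside the orthogonal of `v` contains exactly one isotropic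
vector, and a line in an anisotropic direction inside the orthogonal of `v` contains at most two.
It follows that the isotropic vectors of weight at most `m` number `binom(n, m) q^(m-1)` up to a
factor `1 + O(1/q)`, and that almost all of them have weight `m` and pairwise distinct nonzero
coordinates.

A bad code, that is one of minimum distance at most `m`, contains at least `q - 1` nonzero
isotropic vectors of weight at most `m`, which gives the upper bound (`card_badCodes_le`). For the
lower bound let `t` be the number of isotropic vectors of weight `m` with distinct nonzero
coordinates in a code, divided by `q - 1`. The indicator of a bad code is at least `2 t - t^2`.
The second moment is governed by the codes through two independent orthogonal vectors `v`, `w` of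
this kind. Since the nonzero coordinates are distinct, `w` lies outside the span of `v` and `1`,
so the transitivity relative to `⟨v⟩` applies; as `m + k < n`, the pairs contribute less than the
diagonal by a factor `O(1/q)` (`sum_numThrough_span_le`, `le_card_badCodes`).
-/

namespace SelfOrthogonalCount

open Finset
open scoped Classical

variable {F : Type*} [Field F] {n : ℕ}

/-! ### Isometries moving one isotropic vector to another -/

/-- The map `x ↦ x + c (x · u) u`. For `c (u · u) = -2` it is an isometry: the reflection in `u` if
`u` is anisotropic, and a transvection if the characteristic is two and `u` is isotropic. -/
def shear (u : Fin n → F) (c : F) : (Fin n → F) →ₗ[F] (Fin n → F) where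
  toFun x := x + (c * (x ⬝ᵥ u)) • u
  map_add' x y := by
    rw [add_dotProduct]; module
  map_smul' a x := by
    rw [smul_dotProduct, RingHom.id_apply, smul_eq_mul]; module

lemma shear_apply (u : Fin n → F) (c : F) (x : Fin n → F) :
    shear u c x = x + (c * (x ⬝ᵥ u)) • u := rfl

lemma shear_involutive {u : Fin n → F} {c : F} (h : c * (u ⬝ᵥ u) = -2) :
    Function.Involutive (shear u c) := by
  intro x
  simp only [shear_apply, add_dotProduct, smul_dotProduct, smul_eq_mul]
  have : c * (x ⬝ᵥ u + c * (x ⬝ᵥ u) * (u ⬝ᵥ u)) = -(c * (x ⬝ᵥ u)) := by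
    linear_combination (c * (x ⬝ᵥ u)) * h
  rw [this]; module

lemma shear_dotProduct_shear {u : Fin n → F} {c : F} (h : c * (u ⬝ᵥ u) = -2) (x y : Fin n → F) :
    shear u c x ⬝ᵥ shear u c y = x ⬝ᵥ y := by
  simp only [shear_apply, add_dotProduct, smul_dotProduct, dotProduct_add, dotProduct_smul,
    smul_eq_mul, dotProduct_comm u y]
  linear_combination (c * (x ⬝ᵥ u) * (y ⬝ᵥ u)) * h

/-- Two isotropic vectors that are not orthogonal are exchanged by an isometry that fixes every
vector orthogonal to both, in any characteristic. -/
lemma exists_isometry_of_dotProduct_ne_zero {w w' : Fin n → F} (hw : w ⬝ᵥ w = 0)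
    (hw' : w' ⬝ᵥ w' = 0) (h : w ⬝ᵥ w' ≠ 0) :
    ∃ g : (Fin n → F) ≃ₗ[F] (Fin n → F), (∀ x y, g x ⬝ᵥ g y = x ⬝ᵥ y) ∧ g w = w' ∧
      ∀ z, z ⬝ᵥ w = 0 → z ⬝ᵥ w' = 0 → g z = z := by
  have hc : (w ⬝ᵥ w')⁻¹ * ((w - w') ⬝ᵥ (w - w')) = -2 := by
    simp only [sub_dotProduct, dotProduct_sub, hw, hw', dotProduct_comm w' w]
    field_simp
    ring
  refine ⟨LinearEquiv.ofInvolutive _ (shear_involutive hc), shear_dotProduct_shear hc, ?_, ?_⟩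
  · change shear _ _ w = w'
    rw [shear_apply, dotProduct_sub, hw, zero_sub, mul_neg, inv_mul_cancel₀ h]
    module
  · intro z hz hz'
    change shear _ _ z = z
    rw [shear_apply, dotProduct_sub, hz, hz']
    simp

lemma isSelfOrthogonal_map {C : Submodule F (Fin n → F)} (hC : IsSelfOrthogonal C)
    (g : (Fin n → F) ≃ₗ[F] (Fin n → F)) (hg : ∀ x y, g x ⬝ᵥ g y = x ⬝ᵥ y) :
    IsSelfOrthogonal (C.map (g : (Fin n → F) →ₗ[F] (Fin n → F))) := by
  rintro _ ⟨x, hx, rfl⟩ _ ⟨y, hy, rfl⟩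
  exact (hg x y).trans (hC hx y hy)

/-! ### Counting the codes through a vector -/

/-- The functional `x ↦ x · w`. -/
def dotLeft (w : Fin n → F) : (Fin n → F) →ₗ[F] F where
  toFun x := x ⬝ᵥ w
  map_add' x y := add_dotProduct x y w
  map_smul' a x := smul_dotProduct a x w

lemma dotLeft_apply (w x : Fin n → F) : dotLeft w x = x ⬝ᵥ w := rfl

lemma dotProduct_self_of_two_eq_zero (h2 : (2 : F) = 0) (x : Fin n → F) :
    x ⬝ᵥ x = (x ⬝ᵥ 1) ^ 2 := by
  have : CharP F 2 := CharTwo.of_one_ne_zero_of_two_eq_zero one_ne_zero h2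
  rw [dotProduct_one, CharTwo.sum_sq]
  simp [dotProduct, sq]

/-- A subspace of `F^n` is its own double orthogonal. -/
lemma exists_dotProduct_ne_zero_of_notMem {U : Submodule F (Fin n → F)} {w : Fin n → F}
    (hw : w ∉ U) : ∃ x, (∀ z ∈ U, x ⬝ᵥ z = 0) ∧ x ⬝ᵥ w ≠ 0 := by
  obtain ⟨f, hf, hU⟩ := Submodule.exists_le_ker_of_notMem hw
  have key : ∀ z, (fun i => f fun j => if i = j then 1 else 0) ⬝ᵥ z = f z := by
    intro z
    rw [f.pi_apply_eq_sum_univ z, dotProduct_comm]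
    rfl
  refine ⟨fun i => f fun j => if i = j then 1 else 0, fun z hz => ?_, ?_⟩
  · rw [key]; exact hU hz
  · rwa [key]

variable [Fintype F]

/-- The self-orthogonal codes of dimension `k` that contain the subspace `Z`. -/
noncomputable def codesOver (k : ℕ) (Z : Submodule F (Fin n → F)) :
    Finset (Submodule F (Fin n → F)) :=
  (Set.toFinite {C | C ∈ selfOrthogonalCodes F n k ∧ Z ≤ C}).toFinset

lemma mem_codesOver {k : ℕ} {Z C : Submodule F (Fin n → F)} :
    C ∈ codesOver k Z ↔ (Module.finrank F C = k ∧ IsSelfOrthogonal C) ∧ Z ≤ C := by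
  simp [codesOver, selfOrthogonalCodes]

/-- The number of self-orthogonal codes of dimension `k` that contain `Z` and the vector `w`. -/
noncomputable def numThrough (k : ℕ) (Z : Submodule F (Fin n → F)) (w : Fin n → F) : ℕ :=
  #{C ∈ codesOver k Z | w ∈ C}

lemma numThrough_le_of_isometry (k : ℕ) {Z : Submodule F (Fin n → F)} {w w' : Fin n → F}
    (g : (Fin n → F) ≃ₗ[F] (Fin n → F)) (hg : ∀ x y, g x ⬝ᵥ g y = x ⬝ᵥ y) (hw : g w = w')
    (hZ : ∀ z ∈ Z, g z = z) : numThrough k Z w ≤ numThrough k Z w' := by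
  refine Finset.card_le_card_of_injOn
    (fun C => C.map (g : (Fin n → F) →ₗ[F] (Fin n → F))) ?_ ?_
  · intro C hC
    simp only [coe_filter, Set.mem_ofPred_eq, mem_codesOver] at hC ⊢
    obtain ⟨⟨⟨hk, hC⟩, hZC⟩, hwC⟩ := hC
    exact ⟨⟨⟨(LinearEquiv.finrank_map_eq g C).trans hk, isSelfOrthogonal_map hC g hg⟩,
      fun z hz => ⟨z, hZC hz, hZ z hz⟩⟩, ⟨w, hwC, hw⟩⟩
  · exact (Submodule.map_injective_of_injective (f := (g : (Fin n → F) →ₗ[F] (Fin n → F)))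
      g.injective).injOn

lemma numThrough_eq_of_dotProduct_ne_zero (k : ℕ) {Z : Submodule F (Fin n → F)}
    {w w' : Fin n → F} (hw : w ⬝ᵥ w = 0) (hw' : w' ⬝ᵥ w' = 0) (hZ : ∀ z ∈ Z, w ⬝ᵥ z = 0)
    (hZ' : ∀ z ∈ Z, w' ⬝ᵥ z = 0) (h : w ⬝ᵥ w' ≠ 0) : numThrough k Z w = numThrough k Z w' := by
  apply le_antisymm
  · obtain ⟨g, hg, hgw, hgz⟩ := exists_isometry_of_dotProduct_ne_zero hw hw' h
    exact numThrough_le_of_isometry k g hg hgw fun z hz =>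
      hgz z (dotProduct_comm z w ▸ hZ z hz) (dotProduct_comm z w' ▸ hZ' z hz)
  · rw [dotProduct_comm] at h
    obtain ⟨g, hg, hgw, hgz⟩ := exists_isometry_of_dotProduct_ne_zero hw' hw h
    exact numThrough_le_of_isometry k g hg hgw fun z hz =>
      hgz z (dotProduct_comm z w' ▸ hZ' z hz) (dotProduct_comm z w ▸ hZ z hz)

/-- The isotropic vectors orthogonal to `Z` that lie outside the span of `Z` and the all-ones
vector. The latter has to be excluded in characteristic two, where all isotropic vectors are
orthogonal to it. -/
noncomputable def genericVectors (Z : Submodule F (Fin n → F)) : Finset (Fin n → F) :=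
  {w | w ⬝ᵥ w = 0 ∧ (∀ z ∈ Z, w ⬝ᵥ z = 0) ∧ w ∉ Z ⊔ Submodule.span F {1}}

lemma mem_genericVectors {Z : Submodule F (Fin n → F)} {w : Fin n → F} :
    w ∈ genericVectors Z ↔
      w ⬝ᵥ w = 0 ∧ (∀ z ∈ Z, w ⬝ᵥ z = 0) ∧ w ∉ Z ⊔ Submodule.span F {1} := by
  simp [genericVectors]

lemma exists_isotropic_dotProduct_ne_zero {Z : Submodule F (Fin n → F)} {w : Fin n → F}
    (hw : w ∈ genericVectors Z) :
    ∃ x, x ⬝ᵥ x = 0 ∧ (∀ z ∈ Z, x ⬝ᵥ z = 0) ∧ x ⬝ᵥ w ≠ 0 := by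
  obtain ⟨hww, hwZ, hwn⟩ := mem_genericVectors.1 hw
  obtain ⟨x, hx, hxw⟩ := exists_dotProduct_ne_zero_of_notMem hwn
  have hxZ : ∀ z ∈ Z, x ⬝ᵥ z = 0 := fun z hz => hx z (Submodule.mem_sup_left hz)
  by_cases h2 : (2 : F) = 0
  · refine ⟨x, ?_, hxZ, hxw⟩
    rw [dotProduct_self_of_two_eq_zero h2,
      hx 1 (Submodule.mem_sup_right (Submodule.mem_span_singleton_self 1))]
    simp
  · -- subtract the multiple of `w` that makes `x` isotropic; its product with `w` is unchanged
    refine ⟨x - ((x ⬝ᵥ x) / (2 * (x ⬝ᵥ w))) • w, ?_, fun z hz => ?_, ?_⟩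
    · simp only [sub_dotProduct, dotProduct_sub, smul_dotProduct, dotProduct_smul, smul_eq_mul,
        hww, dotProduct_comm w x]
      field_simp
      ring
    · rw [sub_dotProduct, smul_dotProduct, hxZ z hz, hwZ z hz]
      simp
    · rwa [sub_dotProduct, smul_dotProduct, hww, smul_zero, sub_zero]

/-- Any two generic vectors lie in the same number of codes over `Z`: they are joined by a chain of
isotropic vectors orthogonal to `Z` in which consecutive vectors are not orthogonal. -/
lemma numThrough_eq_of_generic (k : ℕ) {Z : Submodule F (Fin n → F)} {w w' : Fin n → F}
    (hw : w ∈ genericVectors Z) (hw' : w' ∈ genericVectors Z) :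
    numThrough k Z w = numThrough k Z w' := by
  obtain ⟨x, hx, hxZ, hxw⟩ := exists_isotropic_dotProduct_ne_zero hw
  obtain ⟨y, hy, hyZ, hyw⟩ := exists_isotropic_dotProduct_ne_zero hw'
  obtain ⟨hww, hwZ, -⟩ := mem_genericVectors.1 hw
  obtain ⟨hww', hwZ', -⟩ := mem_genericVectors.1 hw'
  have step : ∀ u, u ⬝ᵥ u = 0 → (∀ z ∈ Z, u ⬝ᵥ z = 0) → u ⬝ᵥ w ≠ 0 → u ⬝ᵥ w' ≠ 0 →
      numThrough k Z w = numThrough k Z w' := fun u hu huZ h h' =>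
    (numThrough_eq_of_dotProduct_ne_zero k hu hww huZ hwZ h).symm.trans
      (numThrough_eq_of_dotProduct_ne_zero k hu hww' huZ hwZ' h')
  by_cases h1 : x ⬝ᵥ w' = 0
  swap
  · exact step x hx hxZ hxw h1
  by_cases h2 : y ⬝ᵥ w = 0
  swap
  · exact step y hy hyZ h2 hyw
  by_cases h3 : x ⬝ᵥ y = 0
  · refine step (x + y) ?_ (fun z hz => ?_) ?_ ?_
    · simp [add_dotProduct, dotProduct_add, hx, hy, h3, dotProduct_comm y x]
    · rw [add_dotProduct, hxZ z hz, hyZ z hz, add_zero]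
    · rwa [add_dotProduct, h2, add_zero]
    · rwa [add_dotProduct, h1, zero_add]
  · exact ((numThrough_eq_of_dotProduct_ne_zero k hx hww hxZ hwZ hxw).symm.trans
      (numThrough_eq_of_dotProduct_ne_zero k hx hy hxZ hyZ h3)).trans
      (numThrough_eq_of_dotProduct_ne_zero k hy hww' hyZ hwZ' hyw)

lemma sum_numThrough (k : ℕ) (Z : Submodule F (Fin n → F)) (T : Finset (Fin n → F)) :
    ∑ w ∈ T, numThrough k Z w = ∑ C ∈ codesOver k Z, #{w ∈ T | w ∈ C} :=
  Finset.sum_card_bipartiteAbove_eq_sum_card_bipartiteBelow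
    (s := T) (t := codesOver k Z) fun w C => w ∈ C

lemma numThrough_bot (k : ℕ) (v : Fin n → F) :
    numThrough k ⊥ v = #(codesOver k (Submodule.span F {v})) := by
  unfold numThrough
  congr 1
  ext C
  simp [mem_codesOver]

lemma card_mem_submodule (U : Submodule F (Fin n → F)) :
    #{x | x ∈ U} = Fintype.card F ^ Module.finrank F U := by
  rw [← Module.card_eq_pow_finrank (K := F) (V := U), Fintype.card_subtype]

/-- Double counting of the pairs consisting of a generic vector and a code over `Z` through it. -/
lemma numThrough_mul_card_generic_le (k : ℕ) {Z : Submodule F (Fin n → F)} {v : Fin n → F}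
    (hv : v ∈ genericVectors Z) :
    numThrough k Z v * #(genericVectors Z) ≤ #(codesOver k Z) * Fintype.card F ^ k := by
  have h1 : ∑ w ∈ genericVectors Z, numThrough k Z w =
      #(genericVectors Z) * numThrough k Z v := by
    rw [Finset.sum_congr rfl fun w hw => numThrough_eq_of_generic k hw hv, Finset.sum_const,
      smul_eq_mul]
  rw [mul_comm, ← h1, sum_numThrough, ← smul_eq_mul, ← Finset.sum_const]
  refine Finset.sum_le_sum fun C hC => ?_
  rw [← (mem_codesOver.1 hC).1.1, ← card_mem_submodule]
  exact Finset.card_le_card fun x hx => by simp_all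

/-! ### Counting isotropic vectors -/

lemma exists_sq_add_sq_add_one_eq_zero (h2 : (2 : F) ≠ 0) :
    ∃ a b : F, a ^ 2 + b ^ 2 + 1 = 0 := by
  have hc : Fintype.card F % 2 = 1 := FiniteField.odd_card_of_char_ne_two fun h => by
    have := ringChar.Nat.cast_ringChar (R := F)
    rw [h] at this
    exact h2 (by exact_mod_cast this)
  obtain ⟨a, b, h⟩ := FiniteField.exists_root_sum_quadratic
    (f := (Polynomial.X ^ 2 : Polynomial F)) (g := Polynomial.X ^ 2 - Polynomial.C (-1))
    (Polynomial.degree_X_pow 2) (Polynomial.degree_X_pow_sub_C (by norm_num) _) hc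
  refine ⟨a, b, ?_⟩
  simp at h
  linear_combination h

/-- The number of isotropic vectors in the subspace `U`. -/
noncomputable def isoCount (U : Submodule F (Fin n → F)) : ℕ := #{x | x ∈ U ∧ x ⬝ᵥ x = 0}

/-- The subspace of the vectors in `U` orthogonal to `w`. -/
def perpIn (U : Submodule F (Fin n → F)) (w : Fin n → F) : Submodule F (Fin n → F) :=
  U ⊓ LinearMap.ker (dotLeft w)

omit [Fintype F] in
lemma mem_perpIn {U : Submodule F (Fin n → F)} {w x : Fin n → F} :
    x ∈ perpIn U w ↔ x ∈ U ∧ x ⬝ᵥ w = 0 := by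
  simp [perpIn, dotLeft_apply]

lemma card_mul_card_perpIn {U : Submodule F (Fin n → F)} {w : Fin n → F}
    (h : ∃ x ∈ U, x ⬝ᵥ w ≠ 0) :
    Fintype.card F * #{x | x ∈ perpIn U w} = #{x | x ∈ U} := by
  obtain ⟨x, hx, hxw⟩ := h
  rw [← Finset.card_univ (α := F), ← Finset.card_product]
  refine Finset.card_nbij' (fun p => p.2 + p.1 • x)
    (fun z => ((z ⬝ᵥ w) / (x ⬝ᵥ w), z - ((z ⬝ᵥ w) / (x ⬝ᵥ w)) • x)) ?_ ?_ ?_ ?_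
  · rintro ⟨t, y⟩ hy
    simp only [coe_product, coe_filter, Set.mem_prod, Set.mem_ofPred_eq, mem_perpIn, mem_univ,
      true_and] at hy ⊢
    exact U.add_mem hy.2.1 (U.smul_mem t hx)
  · intro z hz
    simp only [coe_product, coe_filter, Set.mem_prod, Set.mem_ofPred_eq, mem_perpIn, mem_univ,
      true_and, coe_univ, Set.mem_univ] at hz ⊢
    refine ⟨U.sub_mem hz (U.smul_mem _ hx), ?_⟩
    rw [sub_dotProduct, smul_dotProduct, smul_eq_mul, div_mul_cancel₀ _ hxw, sub_self]
  · rintro ⟨t, y⟩ hy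
    simp only [coe_product, coe_filter, Set.mem_prod, Set.mem_ofPred_eq, mem_perpIn, mem_univ,
      true_and] at hy
    simp [add_dotProduct, smul_dotProduct, hy.2.2, hxw]
  · intro z hz
    simp

/-- In odd characteristic, each line in the direction of an isotropic `v` that is not contained in
the orthogonal of `v` contains exactly one isotropic vector. -/
lemma card_mul_card_isotropic_not_perp (h2 : (2 : F) ≠ 0) {U : Submodule F (Fin n → F)}
    {v : Fin n → F} (hv : v ∈ U) (hvv : v ⬝ᵥ v = 0) :
    Fintype.card F * #{x | x ∈ U ∧ x ⬝ᵥ x = 0 ∧ x ⬝ᵥ v ≠ 0} =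
      #{x | x ∈ U ∧ x ⬝ᵥ v ≠ 0} := by
  rw [← Finset.card_univ (α := F), ← Finset.card_product]
  refine Finset.card_nbij' (fun p => p.2 + p.1 • v)
    (fun z => ((z ⬝ᵥ z) / (2 * (z ⬝ᵥ v)), z - ((z ⬝ᵥ z) / (2 * (z ⬝ᵥ v))) • v)) ?_ ?_ ?_ ?_
  · rintro ⟨t, y⟩ hy
    simp only [coe_product, coe_filter, Set.mem_prod, Set.mem_ofPred_eq, mem_univ,
      true_and] at hy ⊢
    refine ⟨U.add_mem hy.2.1 (U.smul_mem t hv), ?_⟩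
    rw [add_dotProduct, smul_dotProduct, hvv, smul_zero, add_zero]
    exact hy.2.2.2
  · intro z hz
    simp only [coe_product, coe_filter, Set.mem_prod, Set.mem_ofPred_eq, mem_univ,
      true_and, coe_univ, Set.mem_univ] at hz ⊢
    have hz2 := hz.2
    refine ⟨U.sub_mem hz.1 (U.smul_mem _ hv), ?_, ?_⟩
    · simp only [sub_dotProduct, dotProduct_sub, smul_dotProduct, dotProduct_smul, smul_eq_mul,
        hvv, dotProduct_comm v z]
      field_simp
      ring
    · rwa [sub_dotProduct, smul_dotProduct, hvv, smul_zero, sub_zero]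
  · rintro ⟨t, y⟩ hy
    simp only [coe_product, coe_filter, Set.mem_prod, Set.mem_ofPred_eq, mem_univ,
      true_and] at hy
    have hyv := hy.2.2.2
    have : (y + t • v) ⬝ᵥ (y + t • v) / (2 * ((y + t • v) ⬝ᵥ v)) = t := by
      rw [div_eq_iff (mul_ne_zero h2 (by simpa [add_dotProduct, hvv] using hyv))]
      simp only [add_dotProduct, dotProduct_add, smul_dotProduct, dotProduct_smul, smul_eq_mul,
        hvv, dotProduct_comm v y, hy.2.2.1]
      ring
    simp only [this, Prod.mk.injEq, true_and]
    module
  · intro z hz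
    simp

/-- A line in an anisotropic direction contains at most two isotropic vectors. -/
lemma card_mul_isoCount_le {U : Submodule F (Fin n → F)} {e : Fin n → F} (he : e ∈ U)
    (hee : e ⬝ᵥ e ≠ 0) : Fintype.card F * isoCount U ≤ 2 * #{x | x ∈ U} := by
  rw [isoCount, ← Finset.card_univ (α := F), ← Finset.card_product]
  refine Finset.card_le_mul_card_image_of_maps_to (f := fun p => p.2 + p.1 • e) ?_ 2 ?_
  · rintro ⟨t, y⟩ hy
    simp only [mem_filter, mem_product, mem_univ, true_and] at hy ⊢
    exact U.add_mem hy.1 (U.smul_mem t he)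
  · intro z hz
    by_contra! h
    obtain ⟨⟨t₁, y₁⟩, h1, ⟨t₂, y₂⟩, h2, ⟨t₃, y₃⟩, h3, h12, h13, h23⟩ := Finset.two_lt_card.1 h
    simp only [mem_filter, mem_product, mem_univ, true_and] at h1 h2 h3
    have key : ∀ {t : F} {y : Fin n → F}, y ⬝ᵥ y = 0 → y + t • e = z →
        z ⬝ᵥ z - 2 * t * (z ⬝ᵥ e) + t ^ 2 * (e ⬝ᵥ e) = 0 := by
      rintro t y hy rfl
      simp only [add_dotProduct, dotProduct_add, smul_dotProduct, dotProduct_smul, smul_eq_mul,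
        hy, dotProduct_comm e y]
      ring
    have hne : ∀ {t t' : F} {y y' : Fin n → F}, y + t • e = z → y' + t' • e = z →
        (t, y) ≠ (t', y') → t - t' ≠ 0 := by
      rintro t t' y y' rfl h hn h0
      obtain rfl := sub_eq_zero.1 h0
      exact hn (by rw [add_right_cancel h])
    have k1 := key h1.1.2 h1.2
    have k2 := key h2.1.2 h2.2
    have k3 := key h3.1.2 h3.2
    have n12 := hne h1.2 h2.2 h12
    have n13 := hne h1.2 h3.2 h13
    have n23 := hne h2.2 h3.2 h23
    have e1 : (t₁ + t₂) * (e ⬝ᵥ e) = 2 * (z ⬝ᵥ e) :=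
      mul_left_cancel₀ n12 (by linear_combination k1 - k2)
    have e2 : (t₁ + t₃) * (e ⬝ᵥ e) = 2 * (z ⬝ᵥ e) :=
      mul_left_cancel₀ n13 (by linear_combination k1 - k3)
    exact mul_ne_zero n23 hee (by linear_combination e1 - e2)

lemma isoCount_eq_card_perpIn_one (h2 : (2 : F) = 0) (U : Submodule F (Fin n → F)) :
    isoCount U = #{x | x ∈ perpIn U 1} := by
  unfold isoCount
  congr 1
  ext x
  simp [mem_perpIn, dotProduct_self_of_two_eq_zero h2 x]

lemma card_perpIn_add (U : Submodule F (Fin n → F)) (w : Fin n → F) :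
    #{x | x ∈ perpIn U w} + #{x | x ∈ U ∧ x ⬝ᵥ w ≠ 0} = #{x | x ∈ U} := by
  rw [← Finset.card_filter_add_card_filter_not (s := ({x | x ∈ U} : Finset (Fin n → F)))
    (p := fun x => x ⬝ᵥ w = 0), Finset.filter_filter, Finset.filter_filter]
  simp only [mem_perpIn, ne_eq]

lemma isoCount_perpIn_add (U : Submodule F (Fin n → F)) (w : Fin n → F) :
    isoCount (perpIn U w) + #{x | x ∈ U ∧ x ⬝ᵥ x = 0 ∧ x ⬝ᵥ w ≠ 0} = isoCount U := by
  rw [isoCount, isoCount, ← Finset.card_filter_add_card_filter_not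
    (s := ({x | x ∈ U ∧ x ⬝ᵥ x = 0} : Finset (Fin n → F)))
    (p := fun x => x ⬝ᵥ w = 0), Finset.filter_filter, Finset.filter_filter]
  simp only [mem_perpIn, ne_eq, and_assoc, and_comm, and_left_comm]

/-- In odd characteristic, counting the isotropic vectors outside the orthogonal of an isotropic
vector `v` reduces the count in `U` to the count in the orthogonal of `v`. -/
lemma sq_mul_isoCount (h2 : (2 : F) ≠ 0) {U : Submodule F (Fin n → F)} {v : Fin n → F}
    (hv : v ∈ U) (hvv : v ⬝ᵥ v = 0) (h : ∃ x ∈ U, x ⬝ᵥ v ≠ 0) :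
    Fintype.card F ^ 2 * isoCount U + #{x | x ∈ U} =
      Fintype.card F ^ 2 * isoCount (perpIn U v) + Fintype.card F * #{x | x ∈ U} := by
  have h1 := card_mul_card_perpIn h
  have h3 := card_mul_card_isotropic_not_perp h2 hv hvv
  have h4 := card_perpIn_add U v
  have h5 := isoCount_perpIn_add U v
  rw [← h5]
  have h6 : Fintype.card F ^ 2 * #{x | x ∈ U ∧ x ⬝ᵥ x = 0 ∧ x ⬝ᵥ v ≠ 0} + #{x | x ∈ U} =
      Fintype.card F * #{x | x ∈ U} := by
    rw [sq, mul_assoc, h3]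
    nth_rw 2 [← h4]
    rw [mul_add, h1, add_comm]
  rw [mul_add, add_assoc, h6]

lemma card_mul_card_le_sq_mul_isoCount {U : Submodule F (Fin n → F)} {v : Fin n → F}
    (hv : v ∈ U) (hvv : v ⬝ᵥ v = 0) (h : ∃ x ∈ U, x ⬝ᵥ v ≠ 0) :
    Fintype.card F * #{x | x ∈ U} ≤ Fintype.card F ^ 2 * isoCount U + #{x | x ∈ U} := by
  by_cases h2 : (2 : F) = 0
  · refine le_add_right ?_
    rw [isoCount_eq_card_perpIn_one h2, sq, mul_assoc]
    refine Nat.mul_le_mul_left _ ?_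
    by_cases h1 : ∃ x ∈ U, x ⬝ᵥ 1 ≠ 0
    · exact (card_mul_card_perpIn h1).ge
    · push Not at h1
      refine le_trans (Finset.card_le_card fun x hx => ?_)
        (Nat.le_mul_of_pos_left _ Fintype.card_pos)
      simp only [mem_filter, mem_univ, true_and, mem_perpIn] at hx ⊢
      exact ⟨hx, h1 x hx⟩
  · rw [sq_mul_isoCount h2 hv hvv h]
    exact Nat.le_add_left _ _

/-- The vectors supported on the coordinate set `S`. -/
def coordSubspace (F : Type*) [Field F] {n : ℕ} (S : Finset (Fin n)) :
    Submodule F (Fin n → F) where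
  carrier := {x | ∀ i, i ∉ S → x i = 0}
  add_mem' := by
    intro a b ha hb i hi
    rw [Pi.add_apply, ha i hi, hb i hi, add_zero]
  zero_mem' := by
    intro i _
    rfl
  smul_mem' := by
    intro c x hx i hi
    rw [Pi.smul_apply, hx i hi, smul_zero]

omit [Fintype F] in
lemma mem_coordSubspace {S : Finset (Fin n)} {x : Fin n → F} :
    x ∈ coordSubspace F S ↔ ∀ i, i ∉ S → x i = 0 := Iff.rfl

omit [Fintype F] in
lemma single_mem_coordSubspace {S : Finset (Fin n)} {i : Fin n} (hi : i ∈ S) (a : F) :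
    Pi.single i a ∈ coordSubspace F S := by
  intro j hj
  exact Pi.single_eq_of_ne (by rintro rfl; exact hj hi) _

lemma card_coordSubspace (S : Finset (Fin n)) :
    #{x | x ∈ coordSubspace F S} = Fintype.card F ^ #S := by
  have : ({x | x ∈ coordSubspace F S} : Finset (Fin n → F)) =
      Fintype.piFinset fun i => if i ∈ S then univ else {0} := by
    ext x
    simp only [mem_filter, mem_univ, true_and, mem_coordSubspace, Fintype.mem_piFinset]
    refine forall_congr' fun i => ?_
    by_cases hi : i ∈ S <;> simp [hi]
  rw [this, Fintype.card_piFinset]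
  simp only [apply_ite Finset.card, card_univ, card_singleton]
  rw [Finset.prod_ite_mem, Finset.univ_inter, Finset.prod_const]

/-- On at least three coordinates there is an isotropic vector, whose orthogonal is not totally
isotropic. -/
lemma exists_isotropic_mem_coordSubspace (h2 : (2 : F) ≠ 0) {S : Finset (Fin n)} (hS : 3 ≤ #S) :
    ∃ v ∈ coordSubspace F S, v ⬝ᵥ v = 0 ∧ (∃ x ∈ coordSubspace F S, x ⬝ᵥ v ≠ 0) ∧
      ∃ e ∈ coordSubspace F S, e ⬝ᵥ v = 0 ∧ e ⬝ᵥ e ≠ 0 := by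
  obtain ⟨i, hi, j, hj, l, hl, hij, hil, hjl⟩ := Finset.two_lt_card.1 hS
  obtain ⟨a, b, hab⟩ := exists_sq_add_sq_add_one_eq_zero (F := F) h2
  have mi := single_mem_coordSubspace (F := F) hi
  have mj := single_mem_coordSubspace (F := F) hj
  have ml := single_mem_coordSubspace (F := F) hl
  refine ⟨Pi.single i a + Pi.single j b + Pi.single l 1,
    add_mem (add_mem (mi _) (mj _)) (ml _), ?_, ⟨Pi.single l 1, ml _, ?_⟩, ?_⟩
  · simp [hij, hil, hjl, hij.symm, hil.symm, hjl.symm]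
    linear_combination hab
  · simp [hil.symm, hjl.symm]
  · by_cases hb : b = 0
    · refine ⟨Pi.single j 1 - Pi.single l b, sub_mem (mj _) (ml _), ?_, ?_⟩
      · simp [hij, hil, hjl, hjl.symm]
      · simp [hb]
    · refine ⟨Pi.single i 1 - Pi.single l a, sub_mem (mi _) (ml _), ?_, ?_⟩
      · simp [hil, hjl, hij.symm, hil.symm]
      · simp [hil.symm]
        intro h
        exact hb (pow_eq_zero_iff two_ne_zero |>.1 (by linear_combination hab - h))

lemma isoCount_coordSubspace_bounds {S : Finset (Fin n)} (hS : 3 ≤ #S) :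
    Fintype.card F * Fintype.card F ^ #S ≤
        Fintype.card F ^ 2 * isoCount (coordSubspace F S) + Fintype.card F ^ #S ∧
      Fintype.card F ^ 2 * isoCount (coordSubspace F S) ≤
        (Fintype.card F + 1) * Fintype.card F ^ #S := by
  rw [← card_coordSubspace S]
  by_cases h2 : (2 : F) = 0
  · have h : ∃ x ∈ coordSubspace F S, x ⬝ᵥ 1 ≠ 0 := by
      obtain ⟨i, hi⟩ := Finset.card_pos.1 (lt_of_lt_of_le (by norm_num) hS)
      exact ⟨Pi.single i 1, single_mem_coordSubspace hi 1, by simp⟩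
    rw [isoCount_eq_card_perpIn_one h2, sq, mul_assoc, card_mul_card_perpIn h]
    exact ⟨Nat.le_add_right _ _, Nat.mul_le_mul_right _ (Nat.le_succ _)⟩
  · obtain ⟨v, hv, hvv, hx, e, he, hev, hee⟩ := exists_isotropic_mem_coordSubspace h2 hS
    have h1 := sq_mul_isoCount h2 hv hvv hx
    have h3 := card_mul_card_perpIn hx
    have h4 := card_mul_isoCount_le (mem_perpIn.2 ⟨he, hev⟩) hee
    have h5 : Fintype.card F ^ 2 * isoCount (perpIn (coordSubspace F S) v) ≤
        2 * #{x | x ∈ coordSubspace F S} := by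
      calc _ = Fintype.card F * (Fintype.card F * isoCount (perpIn (coordSubspace F S) v)) := by
            ring
        _ ≤ Fintype.card F * (2 * #{x | x ∈ perpIn (coordSubspace F S) v}) :=
            Nat.mul_le_mul_left _ h4
        _ = 2 * #{x | x ∈ coordSubspace F S} := by rw [← h3]; ring
    exact ⟨h1 ▸ Nat.le_add_left _ _, by linarith⟩

/-- A linear condition with an anisotropic solution cuts the number of isotropic vectors down by
another factor of the order of `q`. -/
lemma sq_mul_isoCount_perpIn_le {U : Submodule F (Fin n → F)} {w : Fin n → F}
    (hx : ∃ x ∈ U, x ⬝ᵥ w ≠ 0) (he : ∃ e ∈ U, e ⬝ᵥ w = 0 ∧ e ⬝ᵥ e ≠ 0) :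
    Fintype.card F ^ 2 * isoCount (perpIn U w) ≤ 2 * #{x | x ∈ U} := by
  obtain ⟨e, he, hew, hee⟩ := he
  calc _ = Fintype.card F * (Fintype.card F * isoCount (perpIn U w)) := by ring
    _ ≤ Fintype.card F * (2 * #{x | x ∈ perpIn U w}) :=
        Nat.mul_le_mul_left _ (card_mul_isoCount_le (mem_perpIn.2 ⟨he, hew⟩) hee)
    _ = 2 * #{x | x ∈ U} := by rw [← card_mul_card_perpIn hx]; ring

/-! ### Isotropic vectors of small weight -/

/-- The nonzero isotropic vectors of weight at most `m`. -/
noncomputable def lowVectors (F : Type*) [Field F] [Fintype F] (n m : ℕ) :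
    Finset (Fin n → F) :=
  {x | x ≠ 0 ∧ x ⬝ᵥ x = 0 ∧ hammingNorm x ≤ m}

/-- The isotropic vectors of weight `m` whose nonzero coordinates are pairwise distinct. Almost all
isotropic vectors of weight `m` are of this kind. Adding a nonzero multiple of the all-ones vector
to a multiple of such a vector leaves at most one zero coordinate. -/
noncomputable def distinctVectors (F : Type*) [Field F] [Fintype F] (n m : ℕ) :
    Finset (Fin n → F) :=
  {x | x ⬝ᵥ x = 0 ∧ hammingNorm x = m ∧ ∀ i j, x i ≠ 0 → x i = x j → i = j}

lemma mem_lowVectors {m : ℕ} {x : Fin n → F} :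
    x ∈ lowVectors F n m ↔ x ≠ 0 ∧ x ⬝ᵥ x = 0 ∧ hammingNorm x ≤ m := by
  simp [lowVectors]

lemma mem_distinctVectors {m : ℕ} {x : Fin n → F} :
    x ∈ distinctVectors F n m ↔
      x ⬝ᵥ x = 0 ∧ hammingNorm x = m ∧ ∀ i j, x i ≠ 0 → x i = x j → i = j := by
  simp [distinctVectors]

lemma distinctVectors_subset_lowVectors {m : ℕ} (hm : m ≠ 0) :
    distinctVectors F n m ⊆ lowVectors F n m := by
  intro x hx
  rw [mem_distinctVectors] at hx
  exact mem_lowVectors.2 ⟨fun h => hm (by rw [← hx.2.1, h, hammingNorm_zero]), hx.1, hx.2.1.le⟩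

lemma sq_mul_card_lowVectors_le {m : ℕ} (hm : 3 ≤ m) (hmn : m ≤ n) :
    Fintype.card F ^ 2 * #(lowVectors F n m) ≤
      n.choose m * ((Fintype.card F + 1) * Fintype.card F ^ m) := by
  have hsub : lowVectors F n m ⊆ (powersetCard m (univ : Finset (Fin n))).biUnion fun S =>
      {x | x ∈ coordSubspace F S ∧ x ⬝ᵥ x = 0} := by
    intro x hx
    obtain ⟨-, hxx, hw⟩ := mem_lowVectors.1 hx
    obtain ⟨S, hS, -, hSm⟩ := Finset.exists_subsuperset_card_eq
      (Finset.subset_univ ({i | x i ≠ 0} : Finset (Fin n))) hw (by simpa using hmn)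
    refine mem_biUnion.2 ⟨S, mem_powersetCard.2 ⟨subset_univ S, hSm⟩, ?_⟩
    simp only [mem_filter, mem_univ, true_and, mem_coordSubspace]
    refine ⟨fun i hi => ?_, hxx⟩
    by_contra h
    exact hi (hS (by simpa using h))
  calc _ ≤ Fintype.card F ^ 2 *
        ∑ S ∈ powersetCard m (univ : Finset (Fin n)), isoCount (coordSubspace F S) :=
        Nat.mul_le_mul_left _ ((card_le_card hsub).trans card_biUnion_le)
    _ ≤ ∑ S ∈ powersetCard m (univ : Finset (Fin n)),
        (Fintype.card F + 1) * Fintype.card F ^ m := by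
        rw [mul_sum]
        refine sum_le_sum fun S hS => ?_
        obtain ⟨-, hS⟩ := mem_powersetCard.1 hS
        have := (isoCount_coordSubspace_bounds (F := F) (hS ▸ hm : 3 ≤ #S)).2
        rwa [hS] at this
    _ = _ := by
        rw [sum_const, card_powersetCard, card_univ, Fintype.card_fin, smul_eq_mul]

/-- The isotropic vectors with support exactly `S` and distinct nonzero coordinates. -/
noncomputable def distinctVectorsOn (F : Type*) [Field F] [Fintype F] {n : ℕ}
    (S : Finset (Fin n)) : Finset (Fin n → F) :=
  {x | x ⬝ᵥ x = 0 ∧ (∀ i, x i ≠ 0 ↔ i ∈ S) ∧ ∀ i ∈ S, ∀ j ∈ S, x i = x j → i = j}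

lemma sq_mul_card_distinctVectorsOn_ge {S : Finset (Fin n)} (hS : 3 ≤ #S) :
    Fintype.card F * Fintype.card F ^ #S ≤
      Fintype.card F ^ 2 * #(distinctVectorsOn F S) +
        (2 * #S ^ 2 + 1) * Fintype.card F ^ #S := by
  set q := Fintype.card F
  have hsub : ({x | x ∈ coordSubspace F S ∧ x ⬝ᵥ x = 0} : Finset (Fin n → F)) ⊆
      distinctVectorsOn F S ∪ ((S.biUnion fun i =>
        {x | x ∈ perpIn (coordSubspace F S) (Pi.single i 1) ∧ x ⬝ᵥ x = 0}) ∪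
        (S.offDiag.biUnion fun p =>
        {x | x ∈ perpIn (coordSubspace F S) (Pi.single p.1 1 - Pi.single p.2 1) ∧
          x ⬝ᵥ x = 0})) := by
    intro x hx
    simp only [mem_filter, mem_univ, true_and] at hx
    obtain ⟨hxS, hxx⟩ := hx
    simp only [mem_union, mem_biUnion, mem_filter, mem_univ, true_and, mem_perpIn, mem_offDiag,
      dotProduct_sub, dotProduct_single, mul_one, distinctVectorsOn, Prod.exists]
    by_cases h0 : ∃ i ∈ S, x i = 0
    · obtain ⟨i, hi, hi0⟩ := h0
      exact Or.inr (Or.inl ⟨i, hi, ⟨hxS, hi0⟩, hxx⟩)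
    by_cases h1 : ∃ i ∈ S, ∃ j ∈ S, i ≠ j ∧ x i = x j
    · obtain ⟨i, hi, j, hj, hij, h⟩ := h1
      exact Or.inr (Or.inr ⟨i, j, ⟨hi, hj, hij⟩, ⟨hxS, sub_eq_zero.2 h⟩, hxx⟩)
    push Not at h0 h1
    refine Or.inl ⟨hxx, fun i => ⟨fun h => ?_, h0 i⟩, fun i hi j hj h => ?_⟩
    · by_contra hi
      exact h (hxS i hi)
    · by_contra hij
      exact h1 i hi j hj hij h
  have hZ : ∀ i ∈ S, q ^ 2 * isoCount (perpIn (coordSubspace F S) (Pi.single i 1)) ≤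
      2 * q ^ #S := by
    intro i hi
    rw [← card_coordSubspace S]
    obtain ⟨j, hj, hji⟩ := Finset.exists_mem_ne (lt_of_lt_of_le (by norm_num) hS) i
    exact sq_mul_isoCount_perpIn_le ⟨Pi.single i 1, single_mem_coordSubspace hi 1, by simp⟩
      ⟨Pi.single j 1, single_mem_coordSubspace hj 1, by simp [hji.symm], by simp⟩
  have hE : ∀ p ∈ S.offDiag, q ^ 2 * isoCount (perpIn (coordSubspace F S)
      (Pi.single p.1 1 - Pi.single p.2 1)) ≤ 2 * q ^ #S := by
    rintro ⟨i, j⟩ hp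
    obtain ⟨hi, hj, hij⟩ := mem_offDiag.1 hp
    simp only at hi hj hij
    rw [← card_coordSubspace S]
    -- the third coordinate is unconstrained, so it provides the anisotropic direction
    obtain ⟨l, hl, hl'⟩ := Finset.exists_mem_notMem_of_card_lt_card
      (lt_of_le_of_lt (card_le_two (a := i) (b := j)) hS)
    simp only [mem_insert, mem_singleton, not_or] at hl'
    exact sq_mul_isoCount_perpIn_le
      ⟨Pi.single i 1, single_mem_coordSubspace hi 1, by simp [dotProduct_sub, hij.symm]⟩
      ⟨Pi.single l 1, single_mem_coordSubspace hl 1,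
        by simp [dotProduct_sub, Ne.symm hl'.1, Ne.symm hl'.2], by simp⟩
  have hlow := (isoCount_coordSubspace_bounds (F := F) hS).1
  have h1 : isoCount (coordSubspace F S) ≤ #(distinctVectorsOn F S) +
      (∑ i ∈ S, isoCount (perpIn (coordSubspace F S) (Pi.single i 1)) +
        ∑ p ∈ S.offDiag, isoCount (perpIn (coordSubspace F S)
          (Pi.single p.1 1 - Pi.single p.2 1))) :=
    (card_le_card hsub).trans ((card_union_le _ _).trans (Nat.add_le_add_left
      ((card_union_le _ _).trans (Nat.add_le_add card_biUnion_le card_biUnion_le)) _))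
  have h2 : q ^ 2 * ∑ i ∈ S, isoCount (perpIn (coordSubspace F S) (Pi.single i 1)) ≤
      #S * (2 * q ^ #S) := by
    rw [mul_sum, ← smul_eq_mul (#S), ← sum_const]
    exact sum_le_sum hZ
  have h3 : q ^ 2 * ∑ p ∈ S.offDiag, isoCount (perpIn (coordSubspace F S)
      (Pi.single p.1 1 - Pi.single p.2 1)) ≤ #S.offDiag * (2 * q ^ #S) := by
    rw [mul_sum, ← smul_eq_mul (#S.offDiag), ← sum_const]
    exact sum_le_sum hE
  have h4 : #S.offDiag + #S = #S ^ 2 := by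
    rw [offDiag_card, sq]
    exact Nat.sub_add_cancel (Nat.le_mul_self _)
  calc q * q ^ #S ≤ q ^ 2 * isoCount (coordSubspace F S) + q ^ #S := hlow
    _ ≤ q ^ 2 * (#(distinctVectorsOn F S) +
      (∑ i ∈ S, isoCount (perpIn (coordSubspace F S) (Pi.single i 1)) +
        ∑ p ∈ S.offDiag, isoCount (perpIn (coordSubspace F S)
          (Pi.single p.1 1 - Pi.single p.2 1)))) + q ^ #S := by gcongr
    _ ≤ q ^ 2 * #(distinctVectorsOn F S) +
      (#S * (2 * q ^ #S) + #S.offDiag * (2 * q ^ #S)) + q ^ #S := by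
        rw [mul_add, mul_add]
        gcongr
    _ = _ := by rw [← h4]; ring

lemma sq_mul_card_distinctVectors_ge {m : ℕ} (hm : 3 ≤ m) :
    n.choose m * (Fintype.card F * Fintype.card F ^ m) ≤
      Fintype.card F ^ 2 * #(distinctVectors F n m) +
        n.choose m * ((2 * m ^ 2 + 1) * Fintype.card F ^ m) := by
  have hdisj : (powersetCard m (univ : Finset (Fin n)) : Set (Finset (Fin n))).PairwiseDisjoint
      (distinctVectorsOn F) := by
    intro S _ T _ hST
    refine Finset.disjoint_left.2 fun x hx hx' => hST ?_
    simp only [distinctVectorsOn, mem_filter, mem_univ, true_and] at hx hx'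
    ext i
    rw [← hx.2.1 i, hx'.2.1 i]
  have hsub : (powersetCard m (univ : Finset (Fin n))).biUnion (distinctVectorsOn F) ⊆
      distinctVectors F n m := by
    intro x hx
    obtain ⟨S, hS, hx⟩ := mem_biUnion.1 hx
    simp only [distinctVectorsOn, mem_filter, mem_univ, true_and] at hx
    refine mem_distinctVectors.2 ⟨hx.1, ?_, fun i j hi hij => ?_⟩
    · rw [← (mem_powersetCard.1 hS).2]
      unfold hammingNorm
      congr 1
      ext i
      simp [hx.2.1 i]
    · exact hx.2.2 i ((hx.2.1 i).1 hi) j ((hx.2.1 j).1 (hij ▸ hi)) hij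
  have hcard : #(powersetCard m (univ : Finset (Fin n))) = n.choose m := by
    rw [card_powersetCard, card_univ, Fintype.card_fin]
  calc n.choose m * (Fintype.card F * Fintype.card F ^ m)
      = ∑ S ∈ powersetCard m (univ : Finset (Fin n)), Fintype.card F * Fintype.card F ^ m := by
        rw [sum_const, hcard, smul_eq_mul]
    _ ≤ ∑ S ∈ powersetCard m (univ : Finset (Fin n)),
        (Fintype.card F ^ 2 * #(distinctVectorsOn F S) +
          (2 * m ^ 2 + 1) * Fintype.card F ^ m) := by
        refine sum_le_sum fun S hS => ?_
        obtain ⟨-, hS⟩ := mem_powersetCard.1 hS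
        have := sq_mul_card_distinctVectorsOn_ge (F := F) (hS ▸ hm : 3 ≤ #S)
        rwa [hS] at this
    _ = Fintype.card F ^ 2 *
          #((powersetCard m (univ : Finset (Fin n))).biUnion (distinctVectorsOn F)) +
        n.choose m * ((2 * m ^ 2 + 1) * Fintype.card F ^ m) := by
        rw [sum_add_distrib, card_biUnion hdisj, mul_sum, sum_const, hcard, smul_eq_mul]
    _ ≤ _ := by gcongr

/-- A vector of weight less than `n` is not a nonzero multiple of the all-ones vector. -/
lemma lowVectors_subset_genericVectors {m : ℕ} (hm : m < n) :
    lowVectors F n m ⊆ genericVectors ⊥ := by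
  intro x hx
  obtain ⟨hx0, hxx, hw⟩ := mem_lowVectors.1 hx
  refine mem_genericVectors.2 ⟨hxx, by simp, ?_⟩
  rw [bot_sup_eq, Submodule.mem_span_singleton]
  rintro ⟨a, rfl⟩
  have ha : a ≠ 0 := by
    rintro rfl
    simp at hx0
  have : hammingNorm (a • (1 : Fin n → F)) = n := by simp [hammingNorm, ha]
  omega

lemma mem_genericVectors_of_mem_distinctVectors {m : ℕ} (hm : m + 1 < n) {v w : Fin n → F}
    (hv : v ∈ distinctVectors F n m) (hw : w ∈ distinctVectors F n m) (hwv : w ⬝ᵥ v = 0)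
    (hwn : w ∉ Submodule.span F {v}) : w ∈ genericVectors (Submodule.span F {v}) := by
  obtain ⟨hvv, hvm, hvd⟩ := mem_distinctVectors.1 hv
  obtain ⟨hww, hwm, -⟩ := mem_distinctVectors.1 hw
  refine mem_genericVectors.2 ⟨hww, fun z hz => ?_, fun h => ?_⟩
  · obtain ⟨a, rfl⟩ := Submodule.mem_span_singleton.1 hz
    rw [dotProduct_smul, hwv, smul_zero]
  obtain ⟨y, hy, z, hz, rfl⟩ := Submodule.mem_sup.1 h
  obtain ⟨a, rfl⟩ := Submodule.mem_span_singleton.1 hy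
  obtain ⟨b, rfl⟩ := Submodule.mem_span_singleton.1 hz
  have hb : b ≠ 0 := by
    rintro rfl
    exact hwn (by simpa using hy)
  -- two distinct zeros of `a v + b 1` would be two equal nonzero coordinates of `v`
  have hzero : #({i | (a • v + b • (1 : Fin n → F)) i = 0} : Finset (Fin n)) ≤ 1 := by
    refine Finset.card_le_one.2 fun i hi j hj => ?_
    simp only [mem_filter, mem_univ, true_and, Pi.add_apply, Pi.smul_apply, Pi.one_apply,
      smul_eq_mul, mul_one] at hi hj
    have ha : a ≠ 0 := by
      rintro rfl
      exact hb (by simpa using hi)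
    refine hvd i j (fun h0 => hb (by simpa [h0] using hi)) (mul_left_cancel₀ ha ?_)
    linear_combination hi - hj
  have hsum := Finset.card_filter_add_card_filter_not (s := (univ : Finset (Fin n)))
    (p := fun i => (a • v + b • (1 : Fin n → F)) i = 0)
  rw [card_univ, Fintype.card_fin] at hsum
  have hnorm : #({i | ¬ (a • v + b • (1 : Fin n → F)) i = 0} : Finset (Fin n)) = m := hwm
  omega

/-! ### The share of the codes through a generic vector -/

omit [Fintype F] in
lemma finrank_span_singleton_le_one (v : Fin n → F) :
    Module.finrank F (Submodule.span F {v}) ≤ 1 := by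
  simpa using finrank_span_le_card (R := F) ({v} : Set (Fin n → F))

lemma card_mem_span_singleton_le (v : Fin n → F) :
    #{x | x ∈ Submodule.span F {v}} ≤ Fintype.card F := by
  rw [card_mem_submodule]
  exact (Nat.pow_le_pow_right Fintype.card_pos (finrank_span_singleton_le_one v)).trans
    (pow_one _).le

lemma isoCount_le_card_genericVectors_add :
    isoCount (⊤ : Submodule F (Fin n → F)) ≤ #(genericVectors (⊥ : Submodule F (Fin n → F))) +
      Fintype.card F := by
  refine le_trans (card_le_card (t := genericVectors ⊥ ∪
    ({x | x ∈ Submodule.span F {1}} : Finset (Fin n → F))) fun x hx => ?_)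
    ((card_union_le _ _).trans (Nat.add_le_add_left (card_mem_span_singleton_le 1) _))
  simp only [mem_filter, mem_univ, Submodule.mem_top, true_and] at hx
  simp only [mem_union, mem_genericVectors, mem_filter, mem_univ, true_and, bot_sup_eq]
  by_cases h : x ∈ Submodule.span F {1}
  · exact Or.inr h
  · exact Or.inl ⟨hx, by simp, h⟩

lemma card_genericVectors_le_isoCount :
    #(genericVectors (⊥ : Submodule F (Fin n → F))) ≤
      isoCount (⊤ : Submodule F (Fin n → F)) := by
  refine card_le_card fun x hx => ?_
  simpa using (mem_genericVectors.1 hx).1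

lemma isoCount_top_bounds (hn : 3 ≤ n) :
    Fintype.card F * Fintype.card F ^ n ≤
        Fintype.card F ^ 2 * isoCount (⊤ : Submodule F (Fin n → F)) + Fintype.card F ^ n ∧
      Fintype.card F ^ 2 * isoCount (⊤ : Submodule F (Fin n → F)) ≤
        (Fintype.card F + 1) * Fintype.card F ^ n := by
  have htop : coordSubspace F (univ : Finset (Fin n)) = ⊤ := by
    ext x
    simp [mem_coordSubspace]
  have := isoCount_coordSubspace_bounds (F := F) (S := (univ : Finset (Fin n))) (by simpa using hn)
  rwa [htop, card_univ, Fintype.card_fin] at this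

/-- In terms of `q = |F|`, the number of codes, `A` the number of isotropic vectors and `N` the
number of codes through a generic vector, this is `(q^k - q^(k-1)) * |codes| ≤ N * A`. -/
lemma pow_mul_card_codes_le {k : ℕ} (hk : 1 ≤ k) {v : Fin n → F} (hv : v ∈ genericVectors ⊥) :
    Fintype.card F ^ k * #(codesOver k (⊥ : Submodule F (Fin n → F))) ≤
      numThrough k ⊥ v * isoCount (⊤ : Submodule F (Fin n → F)) +
        Fintype.card F ^ (k - 1) * #(codesOver k (⊥ : Submodule F (Fin n → F))) := by
  have hcode : ∀ C ∈ codesOver k (⊥ : Submodule F (Fin n → F)),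
      #{x | x ∈ C} = Fintype.card F ^ k := fun C hC => by
    rw [card_mem_submodule, (mem_codesOver.1 hC).1.1]
  obtain rfl | hk2 := hk.eq_or_lt
  · -- for `k = 1` every nonzero isotropic vector lies in exactly one code
    have hv0 : v ≠ 0 := by
      rintro rfl
      exact (mem_genericVectors.1 hv).2.2 (Submodule.zero_mem _)
    have hN : 1 ≤ numThrough 1 ⊥ v := by
      refine Finset.card_pos.2 ⟨Submodule.span F {v}, ?_⟩
      refine mem_filter.2 ⟨mem_codesOver.2 ⟨⟨finrank_span_singleton hv0, ?_⟩, bot_le⟩,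
        Submodule.mem_span_singleton_self v⟩
      intro x hx y hy
      obtain ⟨a, rfl⟩ := Submodule.mem_span_singleton.1 hx
      obtain ⟨b, rfl⟩ := Submodule.mem_span_singleton.1 hy
      simp [(mem_genericVectors.1 hv).1]
    have hle : ∀ w ∈ ({x | x ≠ 0 ∧ x ⬝ᵥ x = 0} : Finset (Fin n → F)), numThrough 1 ⊥ w ≤ 1 := by
      intro w hw
      simp only [mem_filter, mem_univ, true_and] at hw
      have : ∀ C ∈ ({C ∈ codesOver 1 (⊥ : Submodule F (Fin n → F)) | w ∈ C} :
          Finset (Submodule F (Fin n → F))), C = Submodule.span F {w} := by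
        intro C hC
        obtain ⟨hC, hwC⟩ := mem_filter.1 hC
        refine (Submodule.eq_of_le_of_finrank_eq
          ((Submodule.span_singleton_le_iff_mem w C).2 hwC) ?_).symm
        rw [finrank_span_singleton hw.1, (mem_codesOver.1 hC).1.1]
      exact Finset.card_le_one.2 fun C hC D hD => (this C hC).trans (this D hD).symm
    have hsum := sum_numThrough 1 (⊥ : Submodule F (Fin n → F))
      ({x | x ≠ 0 ∧ x ⬝ᵥ x = 0} : Finset (Fin n → F))
    have hC : ∀ C ∈ codesOver 1 (⊥ : Submodule F (Fin n → F)), Fintype.card F ^ 1 ≤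
        #{w ∈ ({x | x ≠ 0 ∧ x ⬝ᵥ x = 0} : Finset (Fin n → F)) | w ∈ C} + 1 := by
      intro C hC
      rw [← hcode C hC]
      refine (card_le_card (t := insert 0 _) fun x hx => ?_).trans (card_insert_le _ _)
      simp only [mem_filter, mem_univ, true_and, mem_insert] at hx ⊢
      by_cases h : x = 0
      · exact Or.inl h
      · exact Or.inr ⟨⟨h, (mem_codesOver.1 hC).1.2 hx x hx⟩, hx⟩
    have h1 := sum_le_sum hC
    rw [sum_const, sum_add_distrib, ← hsum, sum_const, smul_eq_mul, smul_eq_mul, mul_one] at h1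
    have h2 := (sum_le_sum hle).trans_eq (sum_const 1)
    rw [smul_eq_mul, mul_one] at h2
    have h3 : #({x | x ≠ 0 ∧ x ⬝ᵥ x = 0} : Finset (Fin n → F)) ≤
        isoCount (⊤ : Submodule F (Fin n → F)) := by
      refine card_le_card fun x hx => ?_
      simp only [mem_filter, mem_univ, true_and, Submodule.mem_top] at hx ⊢
      exact hx.2
    have h4 := Nat.mul_le_mul_right (isoCount (⊤ : Submodule F (Fin n → F))) hN
    simp only [tsub_self, pow_zero]
    linarith
  · have hC : ∀ C ∈ codesOver k (⊥ : Submodule F (Fin n → F)), Fintype.card F ^ k ≤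
        #{w ∈ genericVectors (⊥ : Submodule F (Fin n → F)) | w ∈ C} +
          Fintype.card F ^ (k - 1) := by
      intro C hC
      rw [← hcode C hC]
      refine (card_le_card (t := _ ∪ ({x | x ∈ Submodule.span F {1}} : Finset (Fin n → F)))
        fun x hx => ?_).trans ((card_union_le _ _).trans (Nat.add_le_add_left
          ((card_mem_span_singleton_le 1).trans ?_) _))
      · simp only [mem_filter, mem_univ, true_and, mem_union, mem_genericVectors,
          bot_sup_eq] at hx ⊢
        by_cases h : x ∈ Submodule.span F {1}
        · exact Or.inr h
        · exact Or.inl ⟨⟨(mem_codesOver.1 hC).1.2 hx x hx, by simp, h⟩, hx⟩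
      · exact Nat.le_self_pow (by omega) _
    have h1 := sum_le_sum hC
    rw [sum_const, sum_add_distrib, ← sum_numThrough,
      Finset.sum_congr rfl fun w hw => numThrough_eq_of_generic k hw hv,
      sum_const, sum_const, smul_eq_mul, smul_eq_mul, smul_eq_mul] at h1
    have h2 := Nat.mul_le_mul_left (numThrough k ⊥ v) (card_genericVectors_le_isoCount (F := F)
      (n := n))
    linarith

/-- The count of generic vectors orthogonal to a generic vector, in case there are any. -/
lemma pow_le_sq_mul_card_genericVectors_span (hn : 5 ≤ n) {v w : Fin n → F}
    (hv : v ∈ genericVectors ⊥) (hw : w ∈ genericVectors (Submodule.span F {v})) :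
    Fintype.card F ^ n ≤ Fintype.card F ^ 2 * #(genericVectors (Submodule.span F {v})) +
      2 * Fintype.card F ^ (n - 1) := by
  set q := Fintype.card F
  have hq : 0 < q := Fintype.card_pos
  obtain ⟨hww, hwv, -⟩ := mem_genericVectors.1 hw
  have hvs := Submodule.mem_span_singleton_self (R := F) v
  obtain ⟨x, -, hxv, hxw⟩ := exists_isotropic_dotProduct_ne_zero hw
  obtain ⟨y, -, -, hyv⟩ := exists_isotropic_dotProduct_ne_zero hv
  have h1 : q * #{x | x ∈ perpIn (⊤ : Submodule F (Fin n → F)) v} = q ^ n := by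
    rw [card_mul_card_perpIn ⟨y, Submodule.mem_top, hyv⟩, card_mem_submodule]
    simp [q]
  have h2 : #{x | x ∈ perpIn (⊤ : Submodule F (Fin n → F)) v} = q ^ (n - 1) := by
    refine Nat.eq_of_mul_eq_mul_left hq (h1.trans ?_)
    rw [← pow_succ', Nat.sub_add_cancel (by omega)]
  have h3 := card_mul_card_le_sq_mul_isoCount (U := perpIn ⊤ v) (v := w)
    (mem_perpIn.2 ⟨Submodule.mem_top, hwv v hvs⟩) hww
    ⟨x, mem_perpIn.2 ⟨Submodule.mem_top, hxv v hvs⟩, hxw⟩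
  rw [h1, h2] at h3
  have h4 : isoCount (perpIn ⊤ v) ≤ #(genericVectors (Submodule.span F {v})) + q ^ 2 := by
    refine le_trans (card_le_card (t := _ ∪ ({x | x ∈ Submodule.span F {v} ⊔
      Submodule.span F {1}} : Finset (Fin n → F))) fun x hx => ?_) ((card_union_le _ _).trans
      (Nat.add_le_add_left ?_ _))
    · simp only [mem_filter, mem_univ, true_and, mem_union, mem_genericVectors,
        mem_perpIn, Submodule.mem_top] at hx ⊢
      by_cases h : x ∈ Submodule.span F {v} ⊔ Submodule.span F {1}
      · exact Or.inr h
      · refine Or.inl ⟨hx.2, fun z hz => ?_, h⟩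
        obtain ⟨a, rfl⟩ := Submodule.mem_span_singleton.1 hz
        rw [dotProduct_smul, hx.1, smul_zero]
    · rw [card_mem_submodule]
      refine Nat.pow_le_pow_right hq ((Submodule.finrank_add_le_finrank_add_finrank _ _).trans ?_)
      exact Nat.add_le_add (finrank_span_singleton_le_one v) (finrank_span_singleton_le_one 1)
  have h5 : q ^ 2 * q ^ 2 ≤ q ^ (n - 1) := by
    rw [← pow_add]
    exact Nat.pow_le_pow_right hq (by omega)
  have h6 := Nat.mul_le_mul_left (q ^ 2) h4
  linarith

/-! ### First and second moment -/

/-- The self-orthogonal codes of dimension `k` and minimum distance at most `m`. -/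
noncomputable def badCodes (F : Type*) [Field F] [Fintype F] (n k m : ℕ) :
    Finset (Submodule F (Fin n → F)) :=
  {C ∈ codesOver k ⊥ | minDistance C ≤ m}

omit [Fintype F] in
lemma minDistance_le_iff {C : Submodule F (Fin n → F)} (hC : C ≠ ⊥) {m : ℕ} :
    minDistance C ≤ m ↔ ∃ v ∈ C, v ≠ 0 ∧ hammingNorm v ≤ m := by
  constructor
  · intro h
    obtain ⟨u, hu, hu0⟩ := Submodule.exists_mem_ne_zero_of_ne_bot hC
    have hne : {l : ℕ | ∃ v ∈ C, v ≠ 0 ∧ hammingNorm v = l}.Nonempty :=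
      ⟨hammingNorm u, u, hu, hu0, rfl⟩
    obtain ⟨v, hv, hv0, hvm⟩ := Nat.sInf_mem hne
    exact ⟨v, hv, hv0, hvm.le.trans h⟩
  · rintro ⟨v, hv, hv0, hvm⟩
    have hle : minDistance C ≤ hammingNorm v := Nat.sInf_le ⟨v, hv, hv0, rfl⟩
    exact hle.trans hvm

omit [Fintype F] in
lemma hammingNorm_smul_of_ne_zero {a : F} (ha : a ≠ 0) (v : Fin n → F) :
    hammingNorm (a • v) = hammingNorm v := by
  simp [hammingNorm, ha]

lemma ne_bot_of_mem_codesOver {k : ℕ} (hk : 1 ≤ k) {Z C : Submodule F (Fin n → F)}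
    (hC : C ∈ codesOver k Z) : C ≠ ⊥ := by
  rintro rfl
  have := (mem_codesOver.1 hC).1.1
  rw [finrank_bot] at this
  omega

/-- First moment bound: a bad code contains all nonzero multiples of some vector of small weight. -/
lemma card_badCodes_le {k m : ℕ} (hk : 1 ≤ k) (hm : m < n) {v : Fin n → F}
    (hv : v ∈ genericVectors ⊥) :
    Fintype.card F * #(badCodes F n k m) ≤
      #(lowVectors F n m) * numThrough k ⊥ v + #(badCodes F n k m) := by
  have h1 : ∑ w ∈ lowVectors F n m, numThrough k ⊥ w =
      #(lowVectors F n m) * numThrough k ⊥ v := by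
    rw [Finset.sum_congr rfl fun w hw =>
      numThrough_eq_of_generic k (lowVectors_subset_genericVectors hm hw) hv, Finset.sum_const,
      smul_eq_mul]
  have h2 : ∀ C ∈ badCodes F n k m,
      Fintype.card F ≤ #{w ∈ lowVectors F n m | w ∈ C} + 1 := by
    intro C hC
    obtain ⟨hC, hCm⟩ := mem_filter.1 hC
    obtain ⟨u, hu, hu0, hum⟩ := (minDistance_le_iff (ne_bot_of_mem_codesOver hk hC)).1 hCm
    rw [← card_univ (α := F), ← card_erase_add_one (mem_univ (0 : F))]
    refine Nat.add_le_add_right (card_le_card_of_injOn (fun a => a • u) ?_ ?_) 1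
    · intro a ha
      obtain ⟨ha, -⟩ := mem_erase.1 ha
      have hau : a • u ∈ C := C.smul_mem a hu
      exact mem_filter.2 ⟨mem_lowVectors.2 ⟨smul_ne_zero ha hu0,
        (mem_codesOver.1 hC).1.2 hau _ hau,
        (hammingNorm_smul_of_ne_zero ha u).trans_le hum⟩, hau⟩
    · exact (smul_left_injective F hu0).injOn
  have h3 := sum_le_sum h2
  rw [sum_const, sum_add_distrib, sum_const, smul_eq_mul, smul_eq_mul, mul_one] at h3
  have h4 : ∑ C ∈ badCodes F n k m, #{w ∈ lowVectors F n m | w ∈ C} ≤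
      ∑ C ∈ codesOver k ⊥, #{w ∈ lowVectors F n m | w ∈ C} :=
    sum_le_sum_of_subset (filter_subset _ _)
  rw [← sum_numThrough, h1] at h4
  linarith

/-- The codes through `v` contain on average `q - 1 + O(1)` isotropic vectors of weight `m` with
distinct nonzero coordinates: the multiples of `v`, and a number of others that is bounded
independently of `q`. -/
lemma sum_numThrough_span_le {k m : ℕ} (hm : 3 ≤ m) (hmk : m + k + 1 ≤ n) (hk : 1 ≤ k)
    (hn : 5 ≤ n) (hq : 3 ≤ Fintype.card F) {v : Fin n → F} (hv : v ∈ distinctVectors F n m) :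
    ∑ w ∈ distinctVectors F n m, numThrough k (Submodule.span F {v}) w ≤
      (Fintype.card F - 1 + 4 * n.choose m) * numThrough k ⊥ v := by
  set q := Fintype.card F
  set Z := Submodule.span F {v}
  have hm0 : m ≠ 0 := by omega
  have hmn : m < n := by omega
  have hvg : v ∈ genericVectors ⊥ :=
    lowVectors_subset_genericVectors hmn (distinctVectors_subset_lowVectors hm0 hv)
  rw [← Finset.sum_filter_add_sum_filter_not _ (fun w => w ∈ Z), add_mul]
  refine Nat.add_le_add ?_ ?_
  · have hcard : #{w ∈ distinctVectors F n m | w ∈ Z} ≤ q - 1 := by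
      refine Nat.le_sub_one_of_lt (lt_of_lt_of_le (card_lt_card
        (t := {x | x ∈ Z}) ⟨fun x hx => ?_, fun h => ?_⟩) (card_mem_span_singleton_le v))
      · simpa using (mem_filter.1 hx).2
      · have h0 := h (mem_filter.2 ⟨mem_univ _, Z.zero_mem⟩)
        exact (mem_lowVectors.1 (distinctVectors_subset_lowVectors hm0 (mem_filter.1 h0).1)).1 rfl
    refine (sum_le_card_nsmul _ _ (numThrough k ⊥ v) fun w _ => ?_).trans
      (Nat.mul_le_mul_right _ hcard)
    rw [numThrough_bot]
    exact card_filter_le _ _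
  · have hzero : ∀ w ∈ distinctVectors F n m, w ∉ Z → w ∉ genericVectors Z →
        numThrough k Z w = 0 := by
      intro w hw hwZ hwg
      by_contra h
      obtain ⟨C, hC⟩ := card_pos.1 (Nat.pos_of_ne_zero h)
      obtain ⟨hC, hwC⟩ := mem_filter.1 hC
      have hvC : v ∈ C := (mem_codesOver.1 hC).2 (Submodule.mem_span_singleton_self v)
      exact hwg (mem_genericVectors_of_mem_distinctVectors (by omega) hv hw
        ((mem_codesOver.1 hC).1.2 hwC v hvC) hwZ)
    by_cases hex : ∃ u, u ∈ genericVectors Z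
    swap
    · push Not at hex
      rw [sum_eq_zero fun w hw => hzero w (mem_filter.1 hw).1 (mem_filter.1 hw).2 (hex w)]
      exact Nat.zero_le _
    obtain ⟨u, hu⟩ := hex
    have hle : ∑ w ∈ distinctVectors F n m with w ∉ Z, numThrough k Z w ≤
        #(lowVectors F n m) * numThrough k Z u := by
      refine (sum_le_card_nsmul _ _ (numThrough k Z u) fun w hw => ?_).trans
        (Nat.mul_le_mul_right _ (card_le_card ((filter_subset _ _).trans
          (distinctVectors_subset_lowVectors hm0))))
      by_cases hwg : w ∈ genericVectors Z
      · exact (numThrough_eq_of_generic k hwg hu).le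
      · rw [hzero w (mem_filter.1 hw).1 (mem_filter.1 hw).2 hwg]
        exact Nat.zero_le _
    refine hle.trans ?_
    have hM := numThrough_mul_card_generic_le k hu
    rw [← numThrough_bot] at hM
    have hG := pow_le_sq_mul_card_genericVectors_span hn hvg hu
    have hL := sq_mul_card_lowVectors_le (F := F) (n := n) hm hmn.le
    have hpow : q ^ n = q * q ^ (n - 1) := by
      rw [← pow_succ', Nat.sub_add_cancel (by omega)]
    have hpow2 : q ^ m * q ^ k ≤ q ^ (n - 1) := by
      rw [← pow_add]
      exact Nat.pow_le_pow_right (by omega) (by omega)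
    -- the number of vectors of small weight is at most `4 * n.choose m * q ^ (-k)` times the
    -- number of generic vectors over `Z`
    have hLG : #(lowVectors F n m) * q ^ k ≤ 4 * n.choose m * #(genericVectors Z) := by
      have hq2 : 0 < q ^ 2 := by positivity
      refine Nat.le_of_mul_le_mul_left ?_ hq2
      have e1 : (q + 1) * q ^ (n - 1) ≤ 4 * (q ^ 2 * #(genericVectors Z)) := by
        have : 3 * q ^ (n - 1) ≤ q * q ^ (n - 1) := Nat.mul_le_mul_right _ hq
        change q ^ n ≤ q ^ 2 * #(genericVectors Z) + 2 * q ^ (n - 1) at hG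
        linarith
      calc q ^ 2 * (#(lowVectors F n m) * q ^ k)
          = (q ^ 2 * #(lowVectors F n m)) * q ^ k := by ring
        _ ≤ (n.choose m * ((q + 1) * q ^ m)) * q ^ k := Nat.mul_le_mul_right _ hL
        _ = n.choose m * ((q + 1) * (q ^ m * q ^ k)) := by ring
        _ ≤ n.choose m * ((q + 1) * q ^ (n - 1)) := by gcongr
        _ ≤ n.choose m * (4 * (q ^ 2 * #(genericVectors Z))) := by gcongr
        _ = _ := by ring
    refine Nat.le_of_mul_le_mul_left ?_ (card_pos.2 ⟨u, hu⟩)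
    calc #(genericVectors Z) * (#(lowVectors F n m) * numThrough k Z u)
        = #(lowVectors F n m) * (numThrough k Z u * #(genericVectors Z)) := by ring
      _ ≤ #(lowVectors F n m) * (numThrough k ⊥ v * q ^ k) := Nat.mul_le_mul_left _ hM
      _ = (#(lowVectors F n m) * q ^ k) * numThrough k ⊥ v := by ring
      _ ≤ (4 * n.choose m * #(genericVectors Z)) * numThrough k ⊥ v := Nat.mul_le_mul_right _ hLG
      _ = _ := by ring

/-- Second moment bound: with `N` the number of codes through a generic vector and `M` the number
of isotropic vectors of weight `m` with distinct nonzero coordinates, the number of bad codes is at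
least `M N / (q - 1)`, up to a factor `1 - O(1/q)`. -/
lemma le_card_badCodes {k m : ℕ} (hm : 3 ≤ m) (hmk : m + k + 1 ≤ n) (hk : 1 ≤ k)
    (hn : 5 ≤ n) (hq : 3 ≤ Fintype.card F) {v : Fin n → F} (hv : v ∈ genericVectors ⊥) :
    (#(distinctVectors F n m) : ℝ) * numThrough k ⊥ v *
        (Fintype.card F - 1 - 4 * n.choose m) ≤
      ((Fintype.card F : ℝ) - 1) ^ 2 * #(badCodes F n k m) := by
  set q := Fintype.card F
  set D := distinctVectors F n m
  have hm0 : m ≠ 0 := by omega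
  have hN : ∀ w ∈ D, numThrough k ⊥ w = numThrough k ⊥ v := fun w hw =>
    numThrough_eq_of_generic k (lowVectors_subset_genericVectors (by omega)
      (distinctVectors_subset_lowVectors hm0 hw)) hv
  have h1 : ∑ C ∈ codesOver k (⊥ : Submodule F (Fin n → F)), #{w ∈ D | w ∈ C} =
      #D * numThrough k ⊥ v := by
    rw [← sum_numThrough, Finset.sum_congr rfl hN, sum_const, smul_eq_mul]
  have h2 : ∑ C ∈ codesOver k (⊥ : Submodule F (Fin n → F)), #{w ∈ D | w ∈ C} ^ 2 ≤
      #D * ((q - 1 + 4 * n.choose m) * numThrough k ⊥ v) := by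
    have e1 : ∑ C ∈ codesOver k (⊥ : Submodule F (Fin n → F)), #{w ∈ D | w ∈ C} ^ 2 =
        ∑ u ∈ D, ∑ w ∈ D, numThrough k (Submodule.span F {u}) w := by
      simp only [sum_numThrough]
      have : ∀ u : Fin n → F, codesOver k (Submodule.span F {u}) =
          ({C ∈ codesOver k ⊥ | u ∈ C} : Finset (Submodule F (Fin n → F))) := by
        intro u
        ext C
        simp [mem_codesOver]
      simp only [this, sum_filter]
      rw [sum_comm]
      refine sum_congr rfl fun C _ => ?_
      rw [← sum_filter, sum_const, sq, smul_eq_mul]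
    rw [e1, ← smul_eq_mul, ← sum_const]
    refine sum_le_sum fun u hu => ?_
    rw [← hN u hu]
    exact sum_numThrough_span_le hm hmk hk hn hq hu
  have h1' : ∑ C ∈ codesOver k (⊥ : Submodule F (Fin n → F)), (#{w ∈ D | w ∈ C} : ℝ) =
      #D * numThrough k ⊥ v := by exact_mod_cast h1
  have h2' : ∑ C ∈ codesOver k (⊥ : Submodule F (Fin n → F)), (#{w ∈ D | w ∈ C} : ℝ) ^ 2 ≤
      #D * ((q - 1 + 4 * n.choose m) * numThrough k ⊥ v) := by
    have : ((q - 1 : ℕ) : ℝ) = (q : ℝ) - 1 := by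
      rw [Nat.cast_sub (by omega), Nat.cast_one]
    rw [← this]
    exact_mod_cast h2
  -- pointwise, `1 ≥ 2 t - t ^ 2` for `t = #{w ∈ D | w ∈ C} / (q - 1)`
  have h3 : ∀ C ∈ codesOver k (⊥ : Submodule F (Fin n → F)),
      2 * ((q : ℝ) - 1) * #{w ∈ D | w ∈ C} - (#{w ∈ D | w ∈ C} : ℝ) ^ 2 ≤
        if minDistance C ≤ m then ((q : ℝ) - 1) ^ 2 else 0 := by
    intro C hC
    split_ifs with h
    · linarith [sq_nonneg ((q : ℝ) - 1 - #{w ∈ D | w ∈ C})]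
    · have : #{w ∈ D | w ∈ C} = 0 := by
        refine card_eq_zero.2 (filter_eq_empty_iff.2 fun w hw hwC => h ?_)
        have hw := mem_lowVectors.1 (distinctVectors_subset_lowVectors hm0 hw)
        exact (minDistance_le_iff (ne_bot_of_mem_codesOver hk hC)).2 ⟨w, hwC, hw.1, hw.2.2⟩
      rw [this]
      simp
  have h4 := sum_le_sum h3
  rw [sum_sub_distrib, ← mul_sum, h1', ← sum_filter, sum_const, nsmul_eq_mul] at h4
  change _ ≤ (#(badCodes F n k m) : ℝ) * _ at h4
  linarith

/-! ### The asymptotic proportion -/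

lemma codesOver_bot_nonempty {k : ℕ} (hk : k ≤ wittIndex F n) :
    (codesOver k (⊥ : Submodule F (Fin n → F))).Nonempty := by
  have hne : {m : ℕ | ∃ C : Submodule F (Fin n → F),
      IsSelfOrthogonal C ∧ Module.finrank F C = m}.Nonempty :=
    ⟨0, ⊥, bot_le, finrank_bot F _⟩
  have hbdd : BddAbove {m : ℕ | ∃ C : Submodule F (Fin n → F),
      IsSelfOrthogonal C ∧ Module.finrank F C = m} := by
    refine ⟨n, ?_⟩
    rintro _ ⟨C, -, rfl⟩
    simpa using Submodule.finrank_le C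
  obtain ⟨C, hC, hCm⟩ := Nat.sSup_mem hne hbdd
  have hkC : k ≤ Module.finrank F C := hk.trans hCm.ge
  obtain ⟨f, hf⟩ := exists_linearIndependent_of_le_finrank hkC
  have hf' : LinearIndependent F fun i => (f i : Fin n → F) :=
    hf.map' C.subtype C.ker_subtype
  have hle : Submodule.span F (Set.range fun i => (f i : Fin n → F)) ≤ C := by
    rw [Submodule.span_le]
    rintro _ ⟨i, rfl⟩
    exact (f i).2
  exact ⟨_, mem_codesOver.2 ⟨⟨(finrank_span_eq_card hf').trans (Fintype.card_fin k),
    fun x hx y hy => hC (hle hx) y (hle hy)⟩, bot_le⟩⟩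

lemma smallDistanceProportion_eq (k m : ℕ) :
    smallDistanceProportion F n k (m + 1) =
      (#(badCodes F n k m) : ℝ) / #(codesOver k (⊥ : Submodule F (Fin n → F))) := by
  have h1 : selfOrthogonalCodes F n k =
      (codesOver k (⊥ : Submodule F (Fin n → F)) : Set (Submodule F (Fin n → F))) := by
    ext C
    simp [mem_codesOver, selfOrthogonalCodes]
  have h2 : selfOrthogonalCodes F n k ∩ {C | minDistance C ≤ m + 1 - 1} =
      (badCodes F n k m : Set (Submodule F (Fin n → F))) := by
    rw [h1]
    ext C
    simp [badCodes]
  rw [smallDistanceProportion, h2, h1, Set.ncard_coe_finset, Set.ncard_coe_finset]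

/-- Explicit bounds for the proportion of the codes of small distance over a fixed field. -/
lemma smallDistanceProportion_bounds {k m : ℕ} (hm : 3 ≤ m) (hmk : m + k + 1 ≤ n) (hk : 1 ≤ k)
    (hkw : k ≤ wittIndex F n) {q : ℝ} (hqF : q = Fintype.card F)
    (hq1 : 2 * m ^ 2 + 1 < q) (hq2 : 1 + 4 * n.choose m < q) :
    (q - 1 - 4 * n.choose m) / (q - 1) * ((q - (2 * m ^ 2 + 1)) / (q + 1)) *
        (n.choose m * q ^ ((m + 1 : ℤ) + k - n - 2)) ≤
      smallDistanceProportion F n k (m + 1) ∧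
    smallDistanceProportion F n k (m + 1) ≤
      (q + 1) / (q - 1) * (q / (q - 2)) * (n.choose m * q ^ ((m + 1 : ℤ) + k - n - 2)) := by
  have hm9 : (9 : ℝ) ≤ (m : ℝ) ^ 2 := by
    have : (3 : ℝ) ≤ m := by exact_mod_cast hm
    nlinarith
  have hq3 : 3 < q := by linarith
  have hq0 : 0 < q := by linarith
  have hq3' : 3 ≤ Fintype.card F := by
    rw [hqF] at hq3
    exact_mod_cast hq3.le
  have hb : (0 : ℝ) < n.choose m := by
    exact_mod_cast Nat.choose_pos (by omega)
  have hσ : (0 : ℝ) < #(codesOver k (⊥ : Submodule F (Fin n → F))) := by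
    exact_mod_cast card_pos.2 (codesOver_bot_nonempty hkw)
  -- the facts about cardinalities, as inequalities between real numbers
  have fD : (n.choose m : ℝ) * (q * q ^ m) ≤ q ^ 2 * #(distinctVectors F n m) +
      n.choose m * ((2 * m ^ 2 + 1) * q ^ m) := by
    rw [hqF]
    exact_mod_cast sq_mul_card_distinctVectors_ge (F := F) (n := n) hm
  have hDpos : 0 < #(distinctVectors F n m) := by
    have h1 : 0 < (n.choose m : ℝ) * ((q - (2 * m ^ 2 + 1)) * q ^ m) :=
      mul_pos hb (mul_pos (by linarith) (by positivity))
    have h2 : 0 < q ^ 2 * (#(distinctVectors F n m) : ℝ) := by linarith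
    exact_mod_cast pos_of_mul_pos_right h2 (by positivity)
  obtain ⟨v, hvD⟩ := card_pos.1 hDpos
  have hv : v ∈ genericVectors ⊥ := lowVectors_subset_genericVectors (m := m) (by omega)
    (distinctVectors_subset_lowVectors (by omega) hvD)
  have fL : q ^ 2 * (#(lowVectors F n m) : ℝ) ≤ n.choose m * ((q + 1) * q ^ m) := by
    rw [hqF]
    exact_mod_cast sq_mul_card_lowVectors_le (F := F) hm (by omega : m ≤ n)
  have fA1 : q * q ^ n ≤ q ^ 2 * (isoCount (⊤ : Submodule F (Fin n → F)) : ℝ) + q ^ n := by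
    rw [hqF]
    exact_mod_cast (isoCount_top_bounds (F := F) (n := n) (by omega)).1
  have fA2 : q ^ 2 * (isoCount (⊤ : Submodule F (Fin n → F)) : ℝ) ≤ (q + 1) * q ^ n := by
    rw [hqF]
    exact_mod_cast (isoCount_top_bounds (F := F) (n := n) (by omega)).2
  have fG : (isoCount (⊤ : Submodule F (Fin n → F)) : ℝ) ≤
      #(genericVectors (⊥ : Submodule F (Fin n → F))) + q := by
    rw [hqF]
    exact_mod_cast isoCount_le_card_genericVectors_add (F := F) (n := n)
  have fN : (numThrough k ⊥ v : ℝ) * #(genericVectors (⊥ : Submodule F (Fin n → F))) ≤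
      #(codesOver k (⊥ : Submodule F (Fin n → F))) * q ^ k := by
    rw [hqF]
    exact_mod_cast numThrough_mul_card_generic_le k hv
  have fN' : q ^ k * (#(codesOver k (⊥ : Submodule F (Fin n → F))) : ℝ) ≤
      numThrough k ⊥ v * isoCount (⊤ : Submodule F (Fin n → F)) +
        q ^ (k - 1) * #(codesOver k (⊥ : Submodule F (Fin n → F))) := by
    rw [hqF]
    exact_mod_cast pow_mul_card_codes_le hk hv
  have fU : q * (#(badCodes F n k m) : ℝ) ≤
      #(lowVectors F n m) * numThrough k ⊥ v + #(badCodes F n k m) := by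
    rw [hqF]
    exact_mod_cast card_badCodes_le hk (by omega : m < n) hv
  have fB := le_card_badCodes (F := F) hm hmk hk (by omega) hq3' hv
  rw [← hqF] at fB
  rw [smallDistanceProportion_eq]
  generalize (#(badCodes F n k m) : ℝ) = B at *
  generalize (#(codesOver k (⊥ : Submodule F (Fin n → F))) : ℝ) = σ at *
  generalize hN : (numThrough k ⊥ v : ℝ) = N at *
  have hN0 : 0 ≤ N := hN ▸ Nat.cast_nonneg _
  generalize hL : (#(lowVectors F n m) : ℝ) = L at *
  have hL0 : 0 ≤ L := hL ▸ Nat.cast_nonneg _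
  generalize hD : (#(distinctVectors F n m) : ℝ) = D at *
  have hD0 : 0 ≤ D := hD ▸ Nat.cast_nonneg _
  generalize (#(genericVectors (⊥ : Submodule F (Fin n → F))) : ℝ) = G at *
  generalize (isoCount (⊤ : Submodule F (Fin n → F)) : ℝ) = A at *
  have hT : (n.choose m * q ^ ((m + 1 : ℤ) + k - n - 2)) * (q * q ^ n) =
      (n.choose m : ℝ) * (q ^ m * q ^ k) := by
    have : q ^ ((m + 1 : ℤ) + k - n - 2) * (q * q ^ n) = q ^ m * q ^ k := by
      have e : ((m + 1 : ℤ) + k - n - 2) + (1 + n) = m + k := by ring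
      rw [← zpow_natCast, ← zpow_natCast, ← zpow_natCast, ← zpow_one_add₀ hq0.ne',
        ← zpow_add₀ hq0.ne', ← zpow_add₀ hq0.ne', e]
    rw [mul_assoc, this]
  generalize (n.choose m : ℝ) * q ^ ((m + 1 : ℤ) + k - n - 2) = T at *
  have hqn : 0 < q ^ n := by positivity
  have hk' : q ^ k = q * q ^ (k - 1) := by
    rw [← pow_succ', Nat.sub_add_cancel hk]
  constructor
  · rw [div_mul_div_comm, div_mul_eq_mul_div, div_le_div_iff₀ (by nlinarith) hσ]
    have hK : 0 ≤ q - 1 - 4 * (n.choose m : ℝ) := by linarith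
    have hc : 0 ≤ q - (2 * (m : ℝ) ^ 2 + 1) := by linarith
    have hpos : 0 < (q - 1) * (q * q ^ n) := by
      have : 0 < q - 1 := by linarith
      positivity
    have fD' : (n.choose m : ℝ) * q ^ m * (q - (2 * m ^ 2 + 1)) ≤ q ^ 2 * D := by linarith
    have fN'' : σ * q ^ k * (q - 1) ≤ q * (N * A) := by
      rw [hk'] at fN' ⊢
      have := mul_le_mul_of_nonneg_left fN' hq0.le
      linarith
    refine le_of_mul_le_mul_right ?_ hpos
    calc (q - 1 - 4 * (n.choose m : ℝ)) * (q - (2 * m ^ 2 + 1)) * T * σ *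
          ((q - 1) * (q * q ^ n))
        = (q - 1 - 4 * (n.choose m : ℝ)) * (q - (2 * m ^ 2 + 1)) * (T * (q * q ^ n)) * σ *
          (q - 1) := by ring
      _ = (q - 1 - 4 * (n.choose m : ℝ)) * (((n.choose m : ℝ) * q ^ m * (q - (2 * m ^ 2 + 1))) *
          (σ * q ^ k * (q - 1))) := by rw [hT]; ring
      _ ≤ (q - 1 - 4 * (n.choose m : ℝ)) * ((q ^ 2 * D) * (q * (N * A))) := by
          refine mul_le_mul_of_nonneg_left (mul_le_mul fD' fN'' ?_ (by positivity)) hK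
          have : 0 < q - 1 := by linarith
          positivity
      _ = (D * N * (q - 1 - 4 * (n.choose m : ℝ))) * q * (q ^ 2 * A) := by ring
      _ ≤ (D * N * (q - 1 - 4 * (n.choose m : ℝ))) * q * ((q + 1) * q ^ n) := by
          refine mul_le_mul_of_nonneg_left fA2 ?_
          positivity
      _ ≤ ((q - 1) ^ 2 * B) * q * ((q + 1) * q ^ n) := by gcongr
      _ = B * ((q - 1) * (q + 1)) * ((q - 1) * (q * q ^ n)) := by ring
  · rw [div_mul_div_comm, div_mul_eq_mul_div, div_le_div_iff₀ hσ (by nlinarith)]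
    refine le_of_mul_le_mul_right ?_ hqn
    have hG : q ^ n * (q - 2) ≤ q ^ 2 * G := by
      have h3 : q ^ 3 ≤ q ^ n := pow_le_pow_right₀ (by linarith) (by omega)
      have := mul_le_mul_of_nonneg_left fG (by positivity : 0 ≤ q ^ 2)
      linarith
    calc B * ((q - 1) * (q - 2)) * q ^ n = (B * (q - 1)) * (q ^ n * (q - 2)) := by ring
      _ ≤ (L * N) * (q ^ 2 * G) := by
          refine mul_le_mul (by linarith) hG ?_ (by positivity)
          exact mul_nonneg hqn.le (by linarith)
      _ = (q ^ 2 * L) * (N * G) := by ring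
      _ ≤ (q ^ 2 * L) * (σ * q ^ k) := by gcongr
      _ ≤ (n.choose m * ((q + 1) * q ^ m)) * (σ * q ^ k) := by gcongr
      _ = (q + 1) * σ * (n.choose m * (q ^ m * q ^ k)) := by ring
      _ = (q + 1) * q * T * σ * q ^ n := by rw [← hT]; ring

lemma tendsto_natCast_add_div_add (a b : ℝ) :
    Tendsto (fun q : ℕ => ((q : ℝ) + a) / (q + b)) atTop (nhds 1) := by
  have h : Tendsto (fun q : ℕ => 1 + (a - b) / ((q : ℝ) + b)) atTop (nhds (1 + 0)) :=
    tendsto_const_nhds.add (tendsto_const_nhds.div_atTop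
      (tendsto_atTop_add_const_right _ b tendsto_natCast_atTop_atTop))
  rw [add_zero] at h
  refine h.congr' ?_
  filter_upwards [tendsto_natCast_atTop_atTop.eventually_gt_atTop (-b)] with q hq
  have : (q : ℝ) + b ≠ 0 := by linarith
  field_simp
  ring

end SelfOrthogonalCount

theorem mainTheorem3 (F : ℕ → Type*) [∀ q, Field (F q)]
    (hF : ∀ q, IsPrimePow q → Nat.card (F q) = q)
    (n d k : ℕ) (hd : 4 ≤ d) (hdn : d < n) (hk : 1 ≤ k) (hkd : k ≤ n - d) :
    (fun q : ℕ => smallDistanceProportion (F q) n k d)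
      ~[atTop ⊓ 𝓟 {q : ℕ | IsPrimePow q ∧ k ≤ wittIndex (F q) n}]
    (fun q : ℕ => (n.choose (d - 1) : ℝ) * (q : ℝ) ^ ((d : ℤ) + k - n - 2)) := by
  obtain ⟨m, rfl⟩ : ∃ m, d = m + 1 := ⟨d - 1, by omega⟩
  simp only [Nat.add_sub_cancel, Nat.cast_add, Nat.cast_one]
  have hb : (0 : ℝ) < n.choose m := by
    exact_mod_cast Nat.choose_pos (by omega)
  set l := atTop ⊓ 𝓟 {q : ℕ | IsPrimePow q ∧ k ≤ wittIndex (F q) n}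
  have hl : l ≤ atTop := inf_le_left
  have hlarge : ∀ a : ℝ, ∀ᶠ q : ℕ in l, a < q := fun a =>
    hl (tendsto_natCast_atTop_atTop.eventually_gt_atTop a)
  have hmem : ∀ᶠ q : ℕ in l, IsPrimePow q ∧ k ≤ wittIndex (F q) n :=
    Filter.mem_inf_of_right (mem_principal_self _)
  have hT : ∀ q : ℕ, (0 : ℝ) < q →
      0 < (n.choose m : ℝ) * (q : ℝ) ^ ((m + 1 : ℤ) + k - n - 2) := fun q hq => by positivity
  rw [isEquivalent_iff_tendsto_one
    ((hlarge 0).mono fun q hq => (hT q hq).ne')]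
  have hbounds : ∀ᶠ q : ℕ in l,
      ((q : ℝ) - 1 - 4 * n.choose m) / (q - 1) * ((q - (2 * m ^ 2 + 1)) / (q + 1)) *
        (n.choose m * (q : ℝ) ^ ((m + 1 : ℤ) + k - n - 2)) ≤
      smallDistanceProportion (F q) n k (m + 1) ∧
      smallDistanceProportion (F q) n k (m + 1) ≤
      ((q : ℝ) + 1) / (q - 1) * (q / (q - 2)) *
        (n.choose m * (q : ℝ) ^ ((m + 1 : ℤ) + k - n - 2)) := by
    filter_upwards [hmem, hlarge (2 * m ^ 2 + 1), hlarge (1 + 4 * n.choose m)] with q hq h1 h2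
    have hcard := hF q hq.1
    have : Finite (F q) := Nat.finite_of_card_ne_zero (by rw [hcard]; exact hq.1.pos.ne')
    have := Fintype.ofFinite (F q)
    exact SelfOrthogonalCount.smallDistanceProportion_bounds (by omega) (by omega) hk hq.2
      (by rw [← Nat.card_eq_fintype_card, hcard]) h1 h2
  have hlow : Tendsto (fun q : ℕ => ((q : ℝ) - 1 - 4 * n.choose m) / (q - 1) *
      ((q - (2 * m ^ 2 + 1)) / (q + 1))) l (nhds 1) := by
    have := ((SelfOrthogonalCount.tendsto_natCast_add_div_add (-1 - 4 * n.choose m) (-1)).mul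
      (SelfOrthogonalCount.tendsto_natCast_add_div_add (-(2 * m ^ 2 + 1)) 1)).mono_left hl
    rw [mul_one] at this
    refine this.congr fun q => ?_
    ring
  have hupp : Tendsto (fun q : ℕ => ((q : ℝ) + 1) / (q - 1) * (q / (q - 2))) l (nhds 1) := by
    have := ((SelfOrthogonalCount.tendsto_natCast_add_div_add 1 (-1)).mul
      (SelfOrthogonalCount.tendsto_natCast_add_div_add 0 (-2))).mono_left hl
    rw [mul_one] at this
    refine this.congr fun q => ?_
    ring
  refine tendsto_of_tendsto_of_tendsto_of_le_of_le' hlow hupp ?_ ?_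
  · filter_upwards [hbounds, hlarge 0] with q hq h0
    exact (le_div_iff₀ (hT q h0)).2 hq.1
  · filter_upwards [hbounds, hlarge 0] with q hq h0
    exact (div_le_iff₀ (hT q h0)).2 hq.2
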